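/- All sets $R$ are subsets of $\mathbb{N}=\{1,2,3,\dots\}$. **Restricted numbers.** For $R\subseteq\mathbb{N}$ and $n,k\ge 1$, let ${n \brace k}_R$, ${n \brack k}_R$ and $L(n,k)_R$ be the numbers of partitions of $[n]=\{1,\dots,n\}$ into $k$ non-empty sets, cyclically ordered sets, and linearly ordered sets, respectively, all of whose cardinalities lie in $R$. Write ${n \brace k}_R^{-1}$, ${n \brack k}_R^{-1}$, $L(n,k)_R^{-1}$ for the entries in row $n$ and column $k$ of the inverses of the infinite matrices $[{n \brace k}_R]_{n,k\ge1}$, $[{n \brack k}_R]_{n,k\ge1}$, $[L(n,k)_R]_{n,k\ge1}$. **The set $R$.** $R$ has *no exposed odds* if (i) $1\in R$ implies $2\in R$, and (ii) $n-1,n+1\in R$ whenever $n\in R$ is odd and $n\ge 3$. Let $a(R)$ be the set of left endpoints, other than $1$, of the maximal intervals of consecutive integers in $R$, and let $b(R)$ be the set of right endpoints of these intervals. For $d\ge1$ put $s_d(n)=d(n-1)+1$ and $R(d)=\{s_d(r):r\in R\}$. **Forests.** A *linearly ordered phylogenetic forest* with $n$ leaves and $k$ components is an unordered collection of $k$ rooted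 trees with $n$ leaves in total (an isolated root is a leaf), in which no vertex has exactly one child, the children of each non-leaf vertex are linearly ordered from left to right, and the leaves are labeled bijectively by $[n]$. It is *increasingly ordered* if, among the children of each vertex, the largest leaf label among the descendant leaves (a leaf being its own descendant) increases from left to right; it is *min-first ordered* if, for each non-leaf vertex $v$, the smallest leaf label among all leaves descended from $v$ is the label of a leaf descended from (or equal to) the left-most child of $v$. Let $d(v)$ be the number of children of $v$. A vertex $v$ has *$s_d(2)$-left-odd ancestry* if there is a path $v_1,\dots,v_m=v$ with $m$ even such that, for $1\le i<m$, $d(v_i)=s_d(2)$ and $v_{i+1}$ is the left-most child of $v_i$, and such that $v_1$ is not the left-most child of a vertex $w$ with $d(w)=s_d(2)$. The forest is *$R(d)$-good* if every vertex $v$ without $s_d(2)$-left-odd ancestry is a leaf or has $d(v)=s_d(2)$ or $d(v)=s_d(a)$ for some $a\in a(R)$, and every vertex $v$ with $s_d(2)$-left-odd ancestry is a leaf or has $d(v)=s_d(b)$ for some $b\in b(R)$. Let $\mathcal{F}^{\rm i.o., good}_{R(d)}(n,k)$, $\mathcal{F}^{\rm m.o., good}_{R(d)}(n,k)$ and $\mathcal{F}^{\rm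 l.o., good}_{R(d)}(n,k)$ be the sets of $R(d)$-good increasingly ordered, min-first ordered and linearly ordered phylogenetic forests with $n$ leaves and $k$ components. **Theorem.** Let $R\subseteq\mathbb{N}$ contain $1$ and have no exposed odds, and let $d\ge1$. Then the matrices $[{n \brace k}_{R(d)}]$, $[{n \brack k}_{R(d)}]$, $[L(n,k)_{R(d)}]$ have unique two-sided inverses, the above sets of forests are finite, and for all $n,k\ge1$ with $d\mid n-k$, $${n \brace k}^{-1}_{R(d)} = (-1)^{(n-k)/d}\left|\mathcal{F}^{\rm i.o., good}_{R(d)}(n,k)\right|,\quad {n \brack k}^{-1}_{R(d)} = (-1)^{(n-k)/d}\left|\mathcal{F}^{\rm m.o., good}_{R(d)}(n,k)\right|,\quad L(n,k)^{-1}_{R(d)} = (-1)^{(n-k)/d}\left|\mathcal{F}^{\rm l.o., good}_{R(d)}(n,k)\right|.$$ If $d\nmid n-k$, the three inverse entries are $0$ and the three sets of forests are empty. -/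

import Mathlib

/-! Throughout, the natural numbers of the paper are the positive ones: `R` is a set of
natural numbers that does not contain `0`, and matrices are indexed by `ℕ+`. -/

/-- `R` has no exposed odds: if `1 ∈ R` then `2 ∈ R`, and every odd `n ≥ 3` in `R` has both
neighbours in `R`. -/
def NoExposedOdds (R : Set ℕ) : Prop :=
  (1 ∈ R → 2 ∈ R) ∧ ∀ n ∈ R, Odd n → 3 ≤ n → n - 1 ∈ R ∧ n + 1 ∈ R

/-- The stretching map `s_d(n) = d (n - 1) + 1` (used only for `n ≥ 1`). -/
def stretch (d n : ℕ) : ℕ := d * (n - 1) + 1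

/-- The stretched set `R(d) = {d (r - 1) + 1 : r ∈ R}`. -/
def stretchSet (R : Set ℕ) (d : ℕ) : Set ℕ := stretch d '' R

/-- `a(R)`: the left endpoints, other than `1`, of the maximal intervals of `R`. -/
def leftEndpoints (R : Set ℕ) : Set ℕ := {a | a ∈ R ∧ a ≠ 1 ∧ a - 1 ∉ R}

/-- `b(R)`: the right endpoints of the maximal intervals of `R`. -/
def rightEndpoints (R : Set ℕ) : Set ℕ := {b | b ∈ R ∧ b + 1 ∉ R}

/-! ### Restricted Stirling and Lah numbers -/

/-- Partitions of an `n`-element set into `k` non-empty blocks, with block sizes in `R`. -/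
def RestrictedPartition (R : Set ℕ) (n k : ℕ) : Type :=
  {P : Finpartition (Finset.univ : Finset (Fin n)) // P.parts.card = k ∧ ∀ B ∈ P.parts, B.card ∈ R}

/-- The matrix of `R`-restricted Stirling numbers of the second kind. -/
noncomputable def stirlingSecond (R : Set ℕ) : Matrix ℕ+ ℕ+ ℚ :=
  fun n k => (Nat.card (RestrictedPartition R n k) : ℚ)

/-- The matrix of `R`-restricted Stirling numbers of the first kind: every block of the
partition carries a cyclic order, given as a permutation of the block with a single orbit. -/
noncomputable def stirlingFirst (R : Set ℕ) : Matrix ℕ+ ℕ+ ℚ :=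
  fun n k => (Nat.card (Σ P : RestrictedPartition R n k,
    ∀ B : P.1.parts, {σ : Equiv.Perm B.1 // σ.IsCycleOn Set.univ}) : ℚ)

/-- The matrix of `R`-restricted Lah numbers: every block `B` of the partition is arranged in a
list, given as a bijection from the positions `0, …, |B| - 1` to `B`. -/
noncomputable def lah (R : Set ℕ) : Matrix ℕ+ ℕ+ ℚ :=
  fun n k => (Nat.card (Σ P : RestrictedPartition R n k,
    ∀ B : P.1.parts, (Fin B.1.card ≃ B.1)) : ℚ)

/-- The product of the infinite matrices `A` and `B` is defined (all sums involved are finite)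
and equal to `C`. -/
def IsMatrixProduct (A B C : Matrix ℕ+ ℕ+ ℚ) : Prop :=
  ∀ n k, (Function.support fun j => A n j * B j k).Finite ∧ ∑ᶠ j, A n j * B j k = C n k

/-- `B` is a two-sided inverse of the infinite matrix `A`. -/
def IsInverseMatrix (A B : Matrix ℕ+ ℕ+ ℚ) : Prop :=
  IsMatrixProduct A B 1 ∧ IsMatrixProduct B A 1

/-! ### Linearly ordered leaf-labelled trees and forests -/

/-- Rooted trees with leaves labelled by natural numbers, in which the children of every
non-leaf vertex are listed from left-most to right-most. -/
inductive OTree : Type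
  | leaf (label : ℕ) : OTree
  | node (children : List OTree) : OTree

namespace OTree

/-- The leaf labels of a tree, from left to right. -/
def leaves : OTree → List ℕ
  | leaf i => [i]
  | node c => c.flatMap leaves

/-- The number of children of the root. -/
def rootDegree : OTree → ℕ
  | leaf _ => 0
  | node c => c.length

/-- Vertices are addressed by the sequence of child positions (counted from `0`) that leads to
them from the root; `T.subtreeAt p` is the subtree formed by the vertex at `p` and its
descendants, if there is a vertex at `p`. -/
def subtreeAt : OTree → List ℕ → Option OTree
  | T, [] => some T
  | leaf _, _ :: _ => none
  | node cs, i :: p => cs[i]?.bind fun T => subtreeAt T p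

/-- `p` is the address of a vertex of `T`. -/
def IsVertex (T : OTree) (p : List ℕ) : Prop := ∃ S, T.subtreeAt p = some S

/-- The down-degree `d(v)` of the vertex `v` of `T` with address `p` (and `0` if there is no such
vertex). -/
def degree (T : OTree) (p : List ℕ) : ℕ := ((T.subtreeAt p).map rootDegree).getD 0

/-- The largest leaf label of a tree, i.e. the value of `ℓ_max` at its root. -/
def maxLabel (T : OTree) : ℕ := T.leaves.max?.getD 0

/-- The smallest leaf label of a tree, i.e. the value of `ℓ_min` at its root. -/
def minLabel (T : OTree) : ℕ := T.leaves.min?.getD 0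

/-- Every non-leaf vertex has at least two children. -/
def IsPhylogenetic (T : OTree) : Prop :=
  ∀ p c, T.subtreeAt p = some (node c) → 2 ≤ c.length

/-- In each complete set of siblings, `ℓ_max` increases from left to right. -/
def IsIncreasing (T : OTree) : Prop :=
  ∀ p c, T.subtreeAt p = some (node c) → c.Pairwise fun S S' => S.maxLabel < S'.maxLabel

/-- In each complete set of siblings, the left-most sibling has the smallest `ℓ_min`. -/
def IsMinFirst (T : OTree) : Prop :=
  ∀ p c, T.subtreeAt p = some (node c) → ∀ S₀ ∈ c.head?, ∀ S ∈ c, S₀.minLabel ≤ S.minLabel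

/-- The vertex `p` of `T` has `s`-left-odd ancestry: there is an ancestor `v₁ = q` of `p` such
that the path `v₁, …, v_k = p` consists of `m = k - 1` steps to a left-most child, each taken from
a vertex of degree `s`, where `k` is even (that is, `m` is odd), and `v₁` is not itself the
left-most child of a vertex of degree `s`. -/
def HasLeftOddAncestry (s : ℕ) (T : OTree) (p : List ℕ) : Prop :=
  ∃ (q : List ℕ) (m : ℕ), Odd m ∧ p = q ++ List.replicate m 0 ∧
    (∀ i < m, T.degree (q ++ List.replicate i 0) = s) ∧
    ¬ ∃ w : List ℕ, q = w ++ [0] ∧ T.degree w = s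

/-- `T` is `R(d)`-good: every vertex without `s_d(2)`-left-odd ancestry is a leaf or has degree
`s_d(2)` or `s_d(a)` with `a ∈ a(R)`, and every vertex with `s_d(2)`-left-odd ancestry is a leaf
or has degree `s_d(b)` with `b ∈ b(R)`. -/
def IsGood (R : Set ℕ) (d : ℕ) (T : OTree) : Prop :=
  ∀ p, T.IsVertex p →
    (¬ HasLeftOddAncestry (stretch d 2) T p →
      T.degree p = 0 ∨ T.degree p = stretch d 2 ∨ ∃ a ∈ leftEndpoints R, T.degree p = stretch d a) ∧
    (HasLeftOddAncestry (stretch d 2) T p →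
      T.degree p = 0 ∨ ∃ b ∈ rightEndpoints R, T.degree p = stretch d b)

end OTree

/-- The linearly ordered phylogenetic forests with `n` leaves and `k` components: unordered
collections of `k` trees whose leaves carry the labels `1, …, n`, each used exactly once. -/
def orderedForests (n k : ℕ) : Set (Multiset OTree) :=
  {F | F.card = k ∧ (∀ T ∈ F, T.IsPhylogenetic) ∧
    (F.map fun T => (T.leaves : Multiset ℕ)).sum = (Finset.Icc 1 n).val}

/-- The `R(d)`-good linearly ordered phylogenetic forests with `n` leaves and `k` components. -/
def goodLinearForests (R : Set ℕ) (d n k : ℕ) : Set (Multiset OTree) :=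
  {F | F ∈ orderedForests n k ∧ ∀ T ∈ F, T.IsGood R d}

/-- The `R(d)`-good increasingly ordered phylogenetic forests with `n` leaves and `k`
components. -/
def goodIncreasingForests (R : Set ℕ) (d n k : ℕ) : Set (Multiset OTree) :=
  {F | F ∈ goodLinearForests R d n k ∧ ∀ T ∈ F, T.IsIncreasing}

/-- The `R(d)`-good min-first ordered phylogenetic forests with `n` leaves and `k` components. -/
def goodMinFirstForests (R : Set ℕ) (d n k : ℕ) : Set (Multiset OTree) :=
  {F | F ∈ goodLinearForests R d n k ∧ ∀ T ∈ F, T.IsMinFirst}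

/-! Everything is encoded in exponential generating functions. Let `coef m` be `1/m!`, `1/m` or `1`
(for sets, cycles, lists) and let `f` be the sum of `coef m * x^m` over `m ∈ R(d)`. Each of the
three matrices has entries `n! [x^n] f^k / k!` (`stirlingSecond_eq`, `stirlingFirst_eq`, `lah_eq`),
so inverting it amounts to inverting `f` under composition (`isInverseMatrix_bellMatrix_iff`).

The inverse series is the generating function `A` of good trees, each tree weighted by `-1` for
every non-leaf vertex. Let `B` count likewise the trees that are good once the root is declared to
have left-odd ancestry. Removing the root gives `A = X - op B - f_M(A)` and `B = X - f_N(A)`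
(`goodTrees_equations`). Here `M`, `N` are the stretched sets `a(R)`, `b(R)`, and `op` puts `d`
trees counted by `A` after a first tree. For each of the three sibling orders, `op` sends `coef j *
A^j` to `coef (j + d) * A^(j + d)` (`SiblingOrder`), so it shifts exponents by `d`.

Comparing endpoints of intervals gives, for indicator functions, `R + (b(R) + 1) = (R + 1) + {1} +
a(R)` (`coefSeries_stretch`). After stretching and substituting `A`, the equations collapse to `D =
op D` for `D = f(A) - X`. Since `op` raises orders, `D = 0` (`SiblingOrder.subst_eq_X`).

It remains to see that the signed counts have no cancellation. Without exposed odds all endpoints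
are even, so every non-leaf degree is `d * r + 1` with `r` odd. Counting leaves then shows that all
good forests with `n` leaves and `k` components have sign `(-1)^((n-k)/d)`
(`card_labels_and_sign_of_mem_goodTrees`). -/

open PowerSeries OTree

/-! ### Antiderivatives of power series -/

/-- The antiderivative of a power series with vanishing constant coefficient. -/
noncomputable def PowerSeries.integ (F : ℚ⟦X⟧) : ℚ⟦X⟧ :=
  PowerSeries.mk fun n => if n = 0 then 0 else coeff (n - 1) F / n

namespace PowerSeries

theorem coeff_succ_integ (F : ℚ⟦X⟧) (n : ℕ) : coeff (n + 1) (integ F) = coeff n F / (n + 1) := by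
  simp [integ]

theorem constantCoeff_integ (F : ℚ⟦X⟧) : constantCoeff (integ F) = 0 := by
  simp [integ, ← coeff_zero_eq_constantCoeff_apply]

theorem derivative_integ (F : ℚ⟦X⟧) : d⁄dX ℚ (integ F) = F := by
  ext n
  rw [coeff_derivative, coeff_succ_integ]
  field_simp

theorem integ_eq {F H : ℚ⟦X⟧} (h0 : constantCoeff H = 0) (h : d⁄dX ℚ H = F) : integ F = H :=
  derivative.ext (by rw [derivative_integ, h]) (by rw [constantCoeff_integ, h0])

theorem integ_add (F G : ℚ⟦X⟧) : integ (F + G) = integ F + integ G :=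
  integ_eq (by simp [constantCoeff_integ]) (by simp [derivative_integ])

theorem X_pow_dvd_integ {F : ℚ⟦X⟧} {j : ℕ} (h : X ^ j ∣ F) : X ^ (j + 1) ∣ integ F := by
  rw [X_pow_dvd_iff] at h ⊢
  rintro (_ | m) hm
  · simp [constantCoeff_integ]
  · rw [coeff_succ_integ, h m (by omega), zero_div]

theorem X_pow_dvd_derivative {F : ℚ⟦X⟧} {j : ℕ} (h : X ^ (j + 1) ∣ F) :
    X ^ j ∣ d⁄dX ℚ F := by
  rw [X_pow_dvd_iff] at h ⊢
  intro m hm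
  rw [coeff_derivative, h _ (by omega), zero_mul]

end PowerSeries

/-! ### Weighted labelled classes and their exponential generating functions -/

section EGF

variable {ι α β : Type*}

/-- `t` lists the objects of the class `X` whose labels are the elements of `S`. -/
def IsFiber (la : α → Multiset ι) (X : Set α) (S : Finset ι) (t : Finset α) : Prop :=
  ∀ x, x ∈ t ↔ x ∈ X ∧ la x = S.val

/-- The class `X` of labelled objects has finitely many objects on every label set, and `G` is the
exponential generating function of its total weights. -/
def HasEGF (la : α → Multiset ι) (X : Set α) (w : α → ℚ) (G : ℚ⟦X⟧) : Prop :=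
  ∀ S : Finset ι, ∃ t : Finset α, IsFiber la X S t ∧
    ∑ x ∈ t, w x = (S.card.factorial : ℚ) * coeff S.card G

theorem IsFiber.unique {la : α → Multiset ι} {X : Set α} {S : Finset ι} {t t' : Finset α}
    (h : IsFiber la X S t) (h' : IsFiber la X S t') : t = t' := by
  ext x
  rw [h x, h' x]

theorem HasEGF.sum_eq {la : α → Multiset ι} {X : Set α} {w : α → ℚ} {G : ℚ⟦X⟧}
    (h : HasEGF la X w G) {S : Finset ι} {t : Finset α} (ht : IsFiber la X S t) :
    ∑ x ∈ t, w x = (S.card.factorial : ℚ) * coeff S.card G := by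
  obtain ⟨t', ht', hs⟩ := h S
  rw [ht.unique ht', hs]

/-- The label type has to be infinite: coefficient `n` is read off on a label set with `n` elements.
-/
theorem HasEGF.unique {la : α → Multiset ℕ} {X : Set α} {w : α → ℚ} {G G' : ℚ⟦X⟧}
    (h : HasEGF la X w G) (h' : HasEGF la X w G') : G = G' := by
  ext n
  obtain ⟨t, ht, hs⟩ := h (Finset.range n)
  have := h'.sum_eq ht
  rw [hs, Finset.card_range] at this
  exact mul_left_cancel₀ (by positivity) this

/-- Classes with weight-preserving bijections on all label sets have the same generating
function. -/
theorem HasEGF.bijOn {la : α → Multiset ι} {X : Set α} {w : α → ℚ} {G : ℚ⟦X⟧}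
    {lb : β → Multiset ι} {Y : Set β} {v : β → ℚ} (h : HasEGF la X w G) (f : α → β)
    (hf : ∀ S : Finset ι, Set.BijOn f {x | x ∈ X ∧ la x = S.val} {y | y ∈ Y ∧ lb y = S.val})
    (hw : ∀ x ∈ X, v (f x) = w x) : HasEGF lb Y v G := by
  classical
  intro S
  obtain ⟨t, ht, hs⟩ := h S
  refine ⟨t.image f, fun y => ?_, ?_⟩
  · rw [Finset.mem_image]
    constructor
    · rintro ⟨x, hx, rfl⟩
      exact (hf S).1 ((ht x).1 hx)
    · intro hy
      obtain ⟨x, hx, rfl⟩ := (hf S).2.2 hy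
      exact ⟨x, (ht x).2 hx, rfl⟩
  · rw [Finset.sum_image, ← hs]
    · exact Finset.sum_congr rfl fun x hx => hw x ((ht x).1 hx).1
    · intro x hx y hy hxy
      exact (hf S).2.1 ((ht x).1 hx) ((ht y).1 hy) hxy

/-- Objects with repeated labels lie in no fiber, so the two classes may differ on them. -/
theorem HasEGF.congr {la : α → Multiset ι} {X Y : Set α} {w : α → ℚ} {G : ℚ⟦X⟧}
    (h : HasEGF la X w G) (hXY : ∀ x, (la x).Nodup → (x ∈ X ↔ x ∈ Y)) : HasEGF la Y w G := by
  intro S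
  obtain ⟨t, ht, hs⟩ := h S
  refine ⟨t, fun x => ?_, hs⟩
  rw [ht x]
  refine and_congr_left fun hx => hXY x ?_
  rw [hx]
  exact S.nodup

theorem HasEGF.empty (la : α → Multiset ι) (w : α → ℚ) : HasEGF la ∅ w 0 :=
  fun _ => ⟨∅, fun _ => by simp, by simp⟩

theorem HasEGF.union {la : α → Multiset ι} {X Y : Set α} {w : α → ℚ} {F G : ℚ⟦X⟧}
    (hX : HasEGF la X w F) (hY : HasEGF la Y w G) (hd : Disjoint X Y) :
    HasEGF la (X ∪ Y) w (F + G) := by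
  classical
  intro S
  obtain ⟨t, ht, hs⟩ := hX S
  obtain ⟨u, hu, hs'⟩ := hY S
  refine ⟨t ∪ u, fun x => ?_, ?_⟩
  · rw [Finset.mem_union, ht, hu, Set.mem_union]
    tauto
  · rw [Finset.sum_union, hs, hs', map_add, mul_add]
    rw [Finset.disjoint_left]
    intro x hx hx'
    exact Set.disjoint_left.1 hd ((ht x).1 hx).1 ((hu x).1 hx').1

theorem HasEGF.neg {la : α → Multiset ι} {X : Set α} {w v : α → ℚ} {G : ℚ⟦X⟧}
    (h : HasEGF la X w G) (hv : ∀ x ∈ X, v x = - w x) : HasEGF la X v (-G) := by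
  intro S
  obtain ⟨t, ht, hs⟩ := h S
  refine ⟨t, ht, ?_⟩
  rw [Finset.sum_congr rfl fun x hx => hv x ((ht x).1 hx).1, Finset.sum_neg_distrib, hs, map_neg,
    mul_neg]

/-- Restriction of a class to the objects whose number of labels satisfies `p`. -/
theorem HasEGF.restrict {la : α → Multiset ι} {X : Set α} {w : α → ℚ} {G : ℚ⟦X⟧}
    (h : HasEGF la X w G) (p : ℕ → Prop) [DecidablePred p] :
    HasEGF la {x | x ∈ X ∧ p (la x).card} w (mk fun n => if p n then coeff n G else 0) := by
  intro S
  obtain ⟨t, ht, hs⟩ := h S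
  by_cases hp : p S.card
  · refine ⟨t, fun x => ?_, by simpa [hp] using hs⟩
    rw [ht]
    constructor
    · rintro ⟨hx, hS⟩
      refine ⟨⟨hx, ?_⟩, hS⟩
      rw [hS]
      exact hp
    · rintro ⟨hx, hS⟩
      exact ⟨hx.1, hS⟩
  · refine ⟨∅, fun x => ?_, by simp [hp]⟩
    simp only [Finset.notMem_empty, Set.mem_ofPred_eq, false_iff]
    rintro ⟨hx, hS⟩
    rw [hS] at hx
    exact hp hx.2

/-- The union of the members of a graded class with degrees in `M`. -/
theorem HasEGF.sum_degrees {la : α → Multiset ι} {X : Set α} {w : α → ℚ} (deg : α → ℕ)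
    {G : ℕ → ℚ⟦X⟧} {H : ℚ⟦X⟧} (M : Set ℕ) [DecidablePred (· ∈ M)]
    (hdeg : ∀ x ∈ X, deg x ≤ (la x).card)
    (h : ∀ m, m ∈ M → HasEGF la {x | x ∈ X ∧ deg x = m} w (G m))
    (hH : ∀ n, coeff n H = ∑ m ∈ Finset.range (n + 1), if m ∈ M then coeff n (G m) else 0) :
    HasEGF la {x | x ∈ X ∧ deg x ∈ M} w H := by
  classical
  intro S
  choose! t ht hs using fun m hm => h m hm S
  -- By `hdeg` no object on `S` has degree above `S.card`, so finitely many degrees suffice.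
  refine ⟨((Finset.range (S.card + 1)).filter (· ∈ M)).biUnion t, fun x => ?_, ?_⟩
  · simp only [Finset.mem_biUnion, Finset.mem_filter, Finset.mem_range, Set.mem_ofPred_eq]
    constructor
    · rintro ⟨m, ⟨-, hm⟩, hx⟩
      obtain ⟨⟨h1, rfl⟩, h3⟩ := (ht m hm x).1 hx
      exact ⟨⟨h1, hm⟩, h3⟩
    · rintro ⟨⟨h1, h2⟩, h3⟩
      refine ⟨deg x, ⟨?_, h2⟩, (ht _ h2 x).2 ⟨⟨h1, rfl⟩, h3⟩⟩
      have := hdeg x h1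
      rw [h3] at this
      exact Nat.lt_succ_of_le this
  · rw [Finset.sum_biUnion, hH, Finset.sum_filter, Finset.mul_sum]
    · refine Finset.sum_congr rfl fun m _ => ?_
      split_ifs with hm
      · exact hs m hm
      · simp
    · intro m hm m' hm' hne
      rw [Function.onFun, Finset.disjoint_left]
      intro x hx hx'
      simp only [Finset.coe_filter, Set.mem_ofPred_eq] at hm hm'
      exact hne (((ht m hm.2 x).1 hx).1.2.symm.trans ((ht m' hm'.2 x).1 hx').1.2)

/-! ### Products of labelled classes, with and without a distinguished label. -/

section Product

variable [DecidableEq ι] {la : α → Multiset ι} {lb : β → Multiset ι} {X : Set α} {Y : Set β}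
  {w : α → ℚ} {v : β → ℚ} {F G : ℚ⟦X⟧}

/-- The pairs with labels `S` whose first component has its label set in `K`. -/
theorem HasEGF.exists_sum_pairs (hX : HasEGF la X w F) (hY : HasEGF lb Y v G)
    (S : Finset ι) (K : Finset (Finset ι)) (hK : K ⊆ S.powerset) :
    ∃ t : Finset (α × β), (∀ z, z ∈ t ↔ (z.1 ∈ X ∧ z.2 ∈ Y ∧ ∃ U ∈ K, la z.1 = U.val) ∧
        la z.1 + lb z.2 = S.val) ∧
      ∑ z ∈ t, w z.1 * v z.2 = ∑ U ∈ K, (U.card.factorial * coeff U.card F) *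
        ((S.card - U.card).factorial * coeff (S.card - U.card) G) := by
  classical
  choose t ht hs using hX
  choose u hu hs' using hY
  refine ⟨K.biUnion fun U => t U ×ˢ u (S \ U), fun z => ?_, ?_⟩
  · simp only [Finset.mem_biUnion, Finset.mem_product, ht _ z.1, hu _ z.2]
    constructor
    · rintro ⟨U, hU, ⟨h1, h2⟩, h3, h4⟩
      refine ⟨⟨h1, h3, U, hU, h2⟩, ?_⟩
      rw [h2, h4, Finset.sdiff_val]
      exact add_tsub_cancel_of_le (Finset.val_le_iff.2 (Finset.mem_powerset.1 (hK hU)))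
    · rintro ⟨⟨h1, h3, U, hU, h2⟩, h5⟩
      refine ⟨U, hU, ⟨h1, h2⟩, h3, ?_⟩
      rw [Finset.sdiff_val, ← h5, ← h2, add_tsub_cancel_left]
  · rw [Finset.sum_biUnion]
    · refine Finset.sum_congr rfl fun U hU => ?_
      rw [Finset.sum_product, ← Finset.card_sdiff_of_subset (Finset.mem_powerset.1 (hK hU)), ← hs,
        ← hs', Finset.sum_mul_sum]
    · intro U hU U' hU' hne
      rw [Function.onFun, Finset.disjoint_left]
      intro z hz hz'
      rw [Finset.mem_product, ht] at hz hz'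
      exact hne (Finset.val_injective (hz.1.2.symm.trans hz'.1.2))

theorem HasEGF.prod (hX : HasEGF la X w F) (hY : HasEGF lb Y v G) :
    HasEGF (fun z : α × β => la z.1 + lb z.2) (X ×ˢ Y) (fun z => w z.1 * v z.2) (F * G) := by
  intro S
  obtain ⟨t, ht, hs⟩ := hX.exists_sum_pairs hY S S.powerset subset_rfl
  refine ⟨t, fun z => ?_, ?_⟩
  · rw [ht, Set.mem_prod]
    refine and_congr_left fun h => ⟨fun h => ⟨h.1, h.2.1⟩, fun h' => ⟨h'.1, h'.2, ?_⟩⟩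
    have hle : la z.1 ≤ S.val := h ▸ Multiset.le_add_right _ _
    exact ⟨⟨la z.1, Multiset.nodup_of_le hle S.nodup⟩,
      Finset.mem_powerset.2 (Finset.val_le_iff.1 hle), rfl⟩
  · rw [hs, Finset.sum_powerset_apply_card (fun m => ((m.factorial : ℚ) * coeff m F) *
      ((S.card - m).factorial * coeff (S.card - m) G)), coeff_mul,
      Finset.Nat.sum_antidiagonal_eq_sum_range_succ_mk, Finset.mul_sum]
    refine Finset.sum_congr rfl fun m hm => ?_
    have hm' : m ≤ S.card := Nat.lt_succ_iff.1 (Finset.mem_range.1 hm)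
    rw [nsmul_eq_mul, ← Nat.choose_mul_factorial_mul_factorial hm']
    push_cast
    ring

/-- Pairs of which the first component contains a distinguished label of the union. -/
theorem HasEGF.pointed_prod (hX : HasEGF la X w F) (hY : HasEGF lb Y v G)
    (Q : α × β → Prop) (hQ0 : ∀ z, Q z → la z.1 ≠ 0)
    (hQ : ∀ S : Finset ι, S.Nonempty → ∃ p ∈ S, ∀ z : α × β, z.1 ∈ X → z.2 ∈ Y →
      la z.1 + lb z.2 = S.val → (Q z ↔ p ∈ la z.1)) :
    HasEGF (fun z : α × β => la z.1 + lb z.2) {z | z.1 ∈ X ∧ z.2 ∈ Y ∧ Q z}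
      (fun z => w z.1 * v z.2) (integ (d⁄dX ℚ F * G)) := by
  intro S
  rcases S.eq_empty_or_nonempty with rfl | hS
  · refine ⟨∅, fun z => ?_, by simp [constantCoeff_integ]⟩
    simp only [Finset.notMem_empty, Set.mem_ofPred_eq, Finset.empty_val, false_iff]
    rintro ⟨h1, h2⟩
    exact hQ0 z h1.2.2 (add_eq_zero.1 h2).1
  obtain ⟨p, hp, hQ⟩ := hQ S hS
  -- The first component may use exactly the subsets of `S` containing `p`, that is `insert p V`
  -- with `V ⊆ S.erase p`. For `S.card = N + 1` the sum runs over `m = V.card` with weight `N.choose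
  -- m`, which produces coefficient `N` of `F' * G`; `integ` moves it to `N + 1`.
  obtain ⟨t, ht, hs⟩ := hX.exists_sum_pairs hY S ((S.erase p).powerset.image
    (insert p)) (by
      intro U hU
      obtain ⟨V, hV, rfl⟩ := Finset.mem_image.1 hU
      rw [Finset.mem_powerset] at hV ⊢
      exact Finset.insert_subset hp (hV.trans (Finset.erase_subset _ _)))
  refine ⟨t, fun z => ?_, ?_⟩
  · rw [ht, Set.mem_ofPred_eq]
    refine and_congr_left fun h => ?_
    constructor
    · rintro ⟨h1, h2, U, hU, h3⟩
      refine ⟨h1, h2, (hQ z h1 h2 h).2 ?_⟩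
      obtain ⟨V, hV, rfl⟩ := Finset.mem_image.1 hU
      rw [h3]
      exact Finset.mem_insert_self _ _
    · rintro ⟨h1, h2, h3⟩
      refine ⟨h1, h2, ?_⟩
      have hle : la z.1 ≤ S.val := h ▸ Multiset.le_add_right _ _
      let U : Finset ι := ⟨la z.1, Multiset.nodup_of_le hle S.nodup⟩
      have hU : p ∈ U := (hQ z h1 h2 h).1 h3
      refine ⟨U, Finset.mem_image.2 ⟨U.erase p, ?_, Finset.insert_erase hU⟩, rfl⟩
      exact Finset.mem_powerset.2 (Finset.erase_subset_erase _ (Finset.val_le_iff.1 hle))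
  · obtain ⟨N, hN⟩ : ∃ N, S.card = N + 1 := ⟨S.card - 1, by have := hS.card_pos; omega⟩
    have hE : (S.erase p).card = N := by rw [Finset.card_erase_of_mem hp, hN]; rfl
    rw [hs, Finset.sum_image, hN]
    · have : ∀ V ∈ (S.erase p).powerset, (insert p V).card = V.card + 1 := by
        intro V hV
        refine Finset.card_insert_of_notMem fun h => ?_
        exact Finset.notMem_erase _ _ (Finset.mem_powerset.1 hV h)
      rw [Finset.sum_congr rfl fun V hV => by rw [this V hV],
        Finset.sum_powerset_apply_card (fun m => (((m + 1).factorial : ℚ) * coeff (m + 1) F) *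
        ((N + 1 - (m + 1)).factorial * coeff (N + 1 - (m + 1)) G)), hE, coeff_succ_integ, coeff_mul,
        Finset.Nat.sum_antidiagonal_eq_sum_range_succ_mk, Nat.factorial_succ]
      push_cast
      rw [mul_div_assoc', mul_right_comm, mul_assoc, mul_div_cancel_left₀ _ (by positivity),
        mul_comm, Finset.mul_sum]
      refine Finset.sum_congr rfl fun m hm => ?_
      have hm' : m ≤ N := Nat.lt_succ_iff.1 (Finset.mem_range.1 hm)
      rw [nsmul_eq_mul, ← Nat.choose_mul_factorial_mul_factorial hm', coeff_derivative,
        Nat.factorial_succ]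
      push_cast
      ring
    · intro U hU V hV h
      simp only [Finset.coe_powerset, Set.mem_preimage, Set.mem_powerset_iff,
        Finset.coe_subset] at hU hV
      have hU' : p ∉ U := fun h => Finset.notMem_erase _ _ (hU h)
      have hV' : p ∉ V := fun h => Finset.notMem_erase _ _ (hV h)
      rw [← Finset.erase_insert hU', ← Finset.erase_insert hV', h]

end Product

/-! ### Extremal labels and unordered collections. -/

/-- The left side does not mention `S`, so it can serve as the predicate `Q` of
`HasEGF.pointed_prod`, which must be the same for all label sets. -/
theorem exists_lt_iff_max'_mem [LinearOrder ι] {u v : Multiset ι} {S : Finset ι}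
    (hS : S.Nonempty) (h : u + v = S.val) : (∃ m ∈ u, ∀ i ∈ v, i < m) ↔ S.max' hS ∈ u := by
  have hmem : ∀ i, i ∈ S ↔ i ∈ u ∨ i ∈ v := fun i => by
    rw [← Multiset.mem_add, h, Finset.mem_val]
  constructor
  · rintro ⟨m, hm, hlt⟩
    refine ((hmem _).1 (S.max'_mem hS)).resolve_right fun hv => ?_
    exact (hlt _ hv).not_ge (S.le_max' m ((hmem m).2 (Or.inl hm)))
  · intro hu
    refine ⟨_, hu, fun i hi => lt_of_le_of_ne (S.le_max' i ((hmem i).2 (Or.inr hi))) ?_⟩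
    rintro rfl
    have hnd : (u + v).Nodup := h ▸ S.nodup
    exact Multiset.disjoint_left.1 (Multiset.nodup_add.1 hnd).2.2 hu hi

theorem exists_lt_iff_min'_mem [LinearOrder ι] {u v : Multiset ι} {S : Finset ι}
    (hS : S.Nonempty) (h : u + v = S.val) : (∃ m ∈ u, ∀ i ∈ v, m < i) ↔ S.min' hS ∈ u :=
  exists_lt_iff_max'_mem (ι := ιᵒᵈ) hS h

theorem integ_derivative_mul_pow {F : ℚ⟦X⟧} (hF : constantCoeff F = 0) (k : ℕ) :
    integ (d⁄dX ℚ F * F ^ k) = ((k : ℚ) + 1)⁻¹ • F ^ (k + 1) := by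
  refine integ_eq (by rw [smul_eq_C_mul, map_mul, map_pow, hF, pow_succ]; simp) ?_
  rw [Derivation.map_smul, derivative_pow, Nat.add_sub_cancel, Nat.cast_succ, smul_eq_C_mul]
  have : (C ((k : ℚ) + 1)⁻¹ : ℚ⟦X⟧) * ((k : ℚ⟦X⟧) + 1) = 1 := by
    have h : ((k : ℚ⟦X⟧) + 1) = C ((k : ℚ) + 1) := by simp
    rw [h, ← map_mul, inv_mul_cancel₀ (by positivity), map_one]
  linear_combination (d⁄dX ℚ F * F ^ k) * this

/-- Unordered collections of `k` objects. -/
theorem HasEGF.multiset [LinearOrder ι] {la : α → Multiset ι} {X : Set α} {w : α → ℚ} {F : ℚ⟦X⟧}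
    (h : HasEGF la X w F) (hne : ∀ x ∈ X, la x ≠ 0) (hF : constantCoeff F = 0) (k : ℕ) :
    HasEGF (fun M : Multiset α => (M.map la).sum) {M | M.card = k ∧ ∀ x ∈ M, x ∈ X}
      (fun M => (M.map w).prod) ((k.factorial : ℚ)⁻¹ • F ^ k) := by
  classical
  induction k with
  | zero =>
    intro S
    rcases S.eq_empty_or_nonempty with rfl | hS
    · refine ⟨{0}, fun M => ?_, by simp⟩
      simp only [Finset.mem_singleton, Set.mem_ofPred_eq, Multiset.card_eq_zero]
      constructor
      · rintro rfl
        simp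
      · exact fun h => h.1.1
    · refine ⟨∅, fun M => ?_, ?_⟩
      · simp only [Finset.notMem_empty, Set.mem_ofPred_eq, Multiset.card_eq_zero, false_iff]
        rintro ⟨⟨rfl, -⟩, h⟩
        simp only [Multiset.map_zero, Multiset.sum_zero] at h
        exact hS.ne_empty (Finset.val_eq_zero.1 h.symm)
      · have := hS.card_pos
        rw [pow_zero, map_smul, coeff_one, if_neg this.ne']
        simp
  | succ k ih =>
    -- A collection of `k + 1` objects is uniquely the object carrying the largest label together
    -- with the `k` others.
    have key := h.pointed_prod ih (fun z => ∃ m ∈ la z.1, ∀ i ∈ (z.2.map la).sum, i < m)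
      (by
        rintro z ⟨m, hm, -⟩ h0
        simp [h0] at hm)
      (fun S hS => ⟨_, S.max'_mem hS, fun z _ _ hz => exists_lt_iff_max'_mem hS hz⟩)
    have hG : integ (d⁄dX ℚ F * ((k.factorial : ℚ)⁻¹ • F ^ k)) =
        ((k + 1).factorial : ℚ)⁻¹ • F ^ (k + 1) := by
      have h1 : integ ((k.factorial : ℚ)⁻¹ • (d⁄dX ℚ F * F ^ k)) =
          (k.factorial : ℚ)⁻¹ • integ (d⁄dX ℚ F * F ^ k) :=
        integ_eq (by simp [constantCoeff_integ]) (by simp [derivative_integ])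
      rw [mul_smul_comm, h1, integ_derivative_mul_pow hF, smul_smul, Nat.factorial_succ]
      push_cast
      rw [mul_inv, mul_comm]
    rw [hG] at key
    refine key.bijOn (fun z => z.1 ::ₘ z.2) (fun S => ⟨?_, ?_, ?_⟩) ?_
    · rintro z ⟨⟨h1, ⟨h2, h3⟩, -⟩, h4⟩
      refine ⟨⟨by simp [h2], ?_⟩, by simpa using h4⟩
      intro x hx
      rcases Multiset.mem_cons.1 hx with rfl | hx
      · exact h1
      · exact h3 x hx
    · rintro ⟨x, M⟩ ⟨⟨-, -, m, hm, hlt⟩, h4⟩ ⟨y, N⟩ ⟨⟨-, -, m', hm', hlt'⟩, h4'⟩ hxy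
      dsimp only at *
      -- Two different heads would each occur in the remainder of the other, so each would have a
      -- label above all labels of the other.
      have hxy' : x = y := by
        by_contra hne
        have hy : y ∈ M := by
          have : y ∈ x ::ₘ M := hxy ▸ Multiset.mem_cons_self y N
          exact (Multiset.mem_cons.1 this).resolve_left (Ne.symm hne)
        have hx : x ∈ N := by
          have : x ∈ y ::ₘ N := hxy ▸ Multiset.mem_cons_self x M
          exact (Multiset.mem_cons.1 this).resolve_left hne
        have h1 := hlt m' (Multiset.mem_join.2 ⟨la y, Multiset.mem_map_of_mem la hy, hm'⟩)
        have h2 := hlt' m (Multiset.mem_join.2 ⟨la x, Multiset.mem_map_of_mem la hx, hm⟩)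
        exact lt_asymm h1 h2
      subst hxy'
      rw [Multiset.cons_inj_right] at hxy
      rw [hxy]
    · rintro M ⟨⟨h1, h2⟩, h3⟩
      have hS : S.Nonempty := by
        obtain ⟨x, hx⟩ := Multiset.card_pos_iff_exists_mem.1 (by omega : 0 < M.card)
        obtain ⟨i, hi⟩ := Multiset.exists_mem_of_ne_zero (hne x (h2 x hx))
        refine ⟨i, ?_⟩
        rw [← Finset.mem_val, ← h3]
        exact Multiset.mem_join.2 ⟨la x, Multiset.mem_map_of_mem la hx, hi⟩
      have hmax : S.max' hS ∈ (M.map la).sum := by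
        rw [h3]
        exact S.max'_mem hS
      obtain ⟨u, hu, hmu⟩ := Multiset.mem_join.1 hmax
      obtain ⟨x, hx, rfl⟩ := Multiset.mem_map.1 hu
      have hM : x ::ₘ M.erase x = M := Multiset.cons_erase hx
      have hsum : la x + ((M.erase x).map la).sum = S.val := by
        rw [← Multiset.sum_cons, ← Multiset.map_cons, hM, h3]
      refine ⟨(x, M.erase x), ⟨⟨h2 x hx, ⟨?_, ?_⟩, ?_⟩, hsum⟩, hM⟩
      · rw [Multiset.card_erase_of_mem hx, h1]
        rfl
      · exact fun y hy => h2 y (Multiset.mem_of_mem_erase hy)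
      · exact (exists_lt_iff_max'_mem hS hsum).2 hmu
    · intro z _
      simp

end EGF

/-! ### Leaf labels and weights of ordered trees -/

namespace OTree

/-- `OTree` is a nested inductive type: its recursor needs a second motive for lists of children,
chosen here as "all members satisfy `P`". -/
theorem induct {P : OTree → Prop} (leaf : ∀ i, P (leaf i))
    (node : ∀ c, (∀ T ∈ c, P T) → P (node c)) (T : OTree) : P T :=
  OTree.rec (motive_1 := P) (motive_2 := fun c => ∀ T ∈ c, P T) leaf node (by simp)
    (fun T c hT hc => by simpa using ⟨hT, hc⟩) T

theorem leaves_leaf (i : ℕ) : (leaf i).leaves = [i] := by simp [leaves]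

theorem leaves_node (c : List OTree) : (node c).leaves = c.flatMap leaves := by simp [leaves]

/-- The multiset of leaf labels. -/
def labels (T : OTree) : Multiset ℕ := T.leaves

/-- The multiset of the leaf labels of a list of trees. -/
def listLabels (l : List OTree) : Multiset ℕ := l.flatMap leaves

/-- The sign `(-1) ^ m`, where `m` is the number of non-leaf vertices. -/
def sign : OTree → ℚ
  | leaf _ => 1
  | node c => -(c.map sign).prod

/-- The product of the signs of a list of trees. -/
def listSign (l : List OTree) : ℚ := (l.map sign).prod

theorem sign_leaf (i : ℕ) : (leaf i).sign = 1 := by simp [sign]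

theorem sign_node (c : List OTree) : (node c).sign = -listSign c := by simp [sign, listSign]

theorem labels_node (c : List OTree) : (node c).labels = listLabels c := by
  rw [labels, leaves_node, listLabels]

theorem listLabels_cons (T : OTree) (l : List OTree) :
    listLabels (T :: l) = T.labels + listLabels l := by
  simp [listLabels, labels]

theorem listLabels_concat (T : OTree) (l : List OTree) :
    listLabels (l ++ [T]) = T.labels + listLabels l := by
  rw [add_comm]
  simp [listLabels, labels]

theorem mem_listLabels {l : List OTree} {i : ℕ} : i ∈ listLabels l ↔ ∃ S ∈ l, i ∈ S.labels := by
  simp [listLabels, labels]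

theorem maxLabel_spec {T : OTree} (h : T.labels ≠ 0) :
    T.maxLabel ∈ T.labels ∧ ∀ i ∈ T.labels, i ≤ T.maxLabel := by
  have hne : T.leaves ≠ [] := by simpa [labels] using h
  obtain ⟨a, ha⟩ := Option.ne_none_iff_exists'.1 (mt List.max?_eq_none_iff.1 hne)
  rw [maxLabel, ha]
  exact List.max?_eq_some_iff.1 ha

theorem minLabel_spec {T : OTree} (h : T.labels ≠ 0) :
    T.minLabel ∈ T.labels ∧ ∀ i ∈ T.labels, T.minLabel ≤ i := by
  have hne : T.leaves ≠ [] := by simpa [labels] using h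
  obtain ⟨a, ha⟩ := Option.ne_none_iff_exists'.1 (mt List.min?_eq_none_iff.1 hne)
  rw [minLabel, ha]
  exact List.min?_eq_some_iff.1 ha

end OTree

/-! ### Lists of trees with a condition on the order of siblings -/

/-- The lists satisfying `Ord` that consist of a tree from `𝓕` followed by `m` trees from `𝓐`. -/
def treeLists (Ord : List OTree → Prop) (𝓐 𝓕 : Set OTree) (m : ℕ) : Set (List OTree) :=
  {l | ∃ T l', l = T :: l' ∧ T ∈ 𝓕 ∧ (∀ S ∈ l', S ∈ 𝓐) ∧ l'.length = m ∧ Ord l}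

/-- An order condition on siblings for which the generating function of `treeLists` is an additive
function `op A m` of the generating function of the first trees. -/
structure SiblingOrder (Ord : List OTree → Prop) where
  /-- The coefficients for which lists of `m` trees have the generating function
  `coef m • A ^ m`. -/
  coef : ℕ → ℚ
  coef_one : coef 1 = 1
  /-- The effect on generating functions of appending `m` trees. -/
  op : ℚ⟦X⟧ → ℕ → ℚ⟦X⟧ →+ ℚ⟦X⟧
  hasEGF : ∀ {𝓐 𝓕 : Set OTree} {A F : ℚ⟦X⟧}, (∀ T ∈ 𝓐, T.labels ≠ 0) → (∀ T ∈ 𝓕, T.labels ≠ 0) →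
    HasEGF labels 𝓐 sign A → HasEGF labels 𝓕 sign F → ∀ m,
    HasEGF listLabels (treeLists Ord 𝓐 𝓕 m) listSign (op A m F)
  -- This field and the next are what the inversion uses: the first makes `op A m` a shift of
  -- exponents by `m` on series in `A`.
  op_pow : ∀ {A : ℚ⟦X⟧}, constantCoeff A = 0 → ∀ m j, 1 ≤ j →
    op A m (coef j • A ^ j) = coef (j + m) • A ^ (j + m)
  -- Orders rise strictly, so `F = op A m F` with `1 ≤ m` forces `F = 0`.
  X_pow_dvd_op : ∀ {A F : ℚ⟦X⟧} {m j : ℕ}, constantCoeff A = 0 → 1 ≤ m → X ^ j ∣ F →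
    X ^ (j + 1) ∣ op A m F

theorem HasEGF.lists {𝓐 : Set OTree} {A : ℚ⟦X⟧} (h : HasEGF labels 𝓐 sign A) (m : ℕ) :
    HasEGF listLabels {l | l.length = m ∧ ∀ S ∈ l, S ∈ 𝓐} listSign (A ^ m) := by
  induction m with
  | zero =>
    intro S
    rcases S.eq_empty_or_nonempty with rfl | hS
    · refine ⟨{[]}, fun l => ?_, by simp [listSign]⟩
      simp only [Finset.mem_singleton, Set.mem_ofPred_eq, List.length_eq_zero_iff]
      constructor
      · rintro rfl
        simp [listLabels]
      · exact fun h => h.1.1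
    · refine ⟨∅, fun l => ?_, ?_⟩
      · simp only [Finset.notMem_empty, Set.mem_ofPred_eq, List.length_eq_zero_iff, false_iff]
        rintro ⟨⟨rfl, -⟩, h⟩
        simp only [listLabels, List.flatMap_nil, Multiset.coe_nil] at h
        exact hS.ne_empty (Finset.val_eq_zero.1 h.symm)
      · have := hS.card_pos
        rw [pow_zero, coeff_one, if_neg this.ne']
        simp
  | succ m ih =>
    rw [pow_succ']
    refine (h.prod ih).bijOn (fun z => z.1 :: z.2) (fun S => ⟨?_, ?_, ?_⟩) ?_
    · rintro ⟨T, l⟩ ⟨⟨h1, h2, h3⟩, h4⟩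
      refine ⟨⟨by simpa using h2, by simpa using ⟨h1, h3⟩⟩, ?_⟩
      rw [listLabels_cons]
      exact h4
    · rintro ⟨T, l⟩ - ⟨T', l'⟩ - h
      simpa using h
    · rintro l ⟨⟨h1, h2⟩, h3⟩
      obtain ⟨T, l, rfl⟩ := List.exists_cons_of_length_eq_add_one h1
      refine ⟨(T, l), ⟨⟨h2 _ (by simp), by simpa using h1, fun S hS => h2 _ (by simp [hS])⟩, ?_⟩,
        rfl⟩
      rw [← h3, listLabels_cons]
    · intro z _
      simp [listSign]

theorem X_dvd_of_constantCoeff_eq_zero {A : ℚ⟦X⟧} (hA : constantCoeff A = 0) : X ^ 1 ∣ A := by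
  rw [pow_one]
  exact X_dvd_iff.2 hA

/-- Siblings in arbitrary order. -/
noncomputable def linearSiblings : SiblingOrder fun _ => True where
  coef _ := 1
  coef_one := rfl
  op A m := AddMonoidHom.mulRight (A ^ m)
  hasEGF {𝓐 𝓕 A F} _ _ hA hF m := by
    refine (hF.prod (hA.lists m)).bijOn (fun z => z.1 :: z.2) (fun S => ⟨?_, ?_, ?_⟩) ?_
    · rintro ⟨T, l⟩ ⟨⟨h1, h2, h3⟩, h4⟩
      refine ⟨⟨T, l, rfl, h1, h3, h2, trivial⟩, ?_⟩
      rw [listLabels_cons]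
      exact h4
    · rintro ⟨T, l⟩ - ⟨T', l'⟩ - h
      simpa using h
    · rintro _ ⟨⟨T, l, rfl, h1, h2, h3, -⟩, h4⟩
      refine ⟨(T, l), ⟨⟨h1, h3, h2⟩, ?_⟩, rfl⟩
      rw [← h4, listLabels_cons]
    · intro z _
      simp [listSign]
  op_pow _ m j _ := by simp [pow_add]
  X_pow_dvd_op {A F m j} hA hm hF := by
    rw [pow_add]
    refine mul_dvd_mul hF ?_
    exact (X_dvd_of_constantCoeff_eq_zero hA).trans (dvd_pow_self A (by omega))

/-- The left-most sibling has the smallest label. -/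
noncomputable def minFirstSiblings :
    SiblingOrder fun c => ∀ S₀ ∈ c.head?, ∀ S ∈ c, S₀.minLabel ≤ S.minLabel where
  coef j := (j : ℚ)⁻¹
  coef_one := by simp
  op A m :=
    { toFun F := integ (d⁄dX ℚ F * A ^ m)
      map_zero' := integ_eq (by simp) (by simp)
      map_add' F G := by rw [map_add, add_mul, integ_add] }
  hasEGF {𝓐 𝓕 A F} h𝓐 h𝓕 hA hF m := by
    -- Min-first means that the smallest label of the whole list lies in the first tree.
    have key := hF.pointed_prod (hA.lists m)
      (fun z => ∃ m ∈ labels z.1, ∀ i ∈ listLabels z.2, m < i)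
      (by
        rintro z ⟨m, hm, -⟩ h0
        simp [h0] at hm)
      (fun S hS => ⟨_, S.min'_mem hS, fun z _ _ hz => exists_lt_iff_min'_mem hS hz⟩)
    refine key.bijOn (fun z => z.1 :: z.2) (fun S => ⟨?_, ?_, ?_⟩) ?_
    · rintro ⟨T, l⟩ ⟨⟨h1, ⟨h2, h3⟩, i, hi, hlt⟩, h4⟩
      refine ⟨⟨T, l, rfl, h1, h3, h2, ?_⟩, ?_⟩
      · simp only [List.head?_cons, Option.mem_some_iff, List.mem_cons, forall_eq',
          forall_eq_or_imp, le_refl, true_and]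
        intro U hU
        have := hlt _ (mem_listLabels.2 ⟨U, hU, (minLabel_spec (h𝓐 U (h3 U hU))).1⟩)
        exact ((minLabel_spec (h𝓕 T h1)).2 i hi).trans this.le
      · rw [listLabels_cons]
        exact h4
    · rintro ⟨T, l⟩ - ⟨T', l'⟩ - h
      simpa using h
    · rintro _ ⟨⟨T, l, rfl, h1, h2, h3, h5⟩, h4⟩
      rw [listLabels_cons] at h4
      refine ⟨(T, l), ⟨⟨h1, ⟨h3, h2⟩, ?_⟩, h4⟩, rfl⟩
      have hT := minLabel_spec (h𝓕 T h1)
      refine ⟨_, hT.1, fun i hi => ?_⟩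
      have hnd : (T.labels + listLabels l).Nodup := h4 ▸ S.nodup
      -- The order condition only gives `≤`; strictness comes from the labels being distinct.
      refine lt_of_le_of_ne ?_ fun h =>
        Multiset.disjoint_left.1 (Multiset.nodup_add.1 hnd).2.2 (h ▸ hT.1) hi
      obtain ⟨U, hU, hiU⟩ := mem_listLabels.1 hi
      exact (h5 T (by simp) U (by simp [hU])).trans ((minLabel_spec (h𝓐 U (h2 U hU))).2 i hiU)
    · intro z _
      simp [listSign]
  op_pow {A} hA m j hj := by
    obtain ⟨j, rfl⟩ : ∃ i, j = i + 1 := ⟨j - 1, by omega⟩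
    have h1 := integ_derivative_mul_pow hA j
    have h2 := integ_derivative_mul_pow hA (j + m)
    change integ (d⁄dX ℚ (((j + 1 : ℕ) : ℚ)⁻¹ • A ^ (j + 1)) * A ^ m) = _
    rw [Nat.cast_succ, ← h1, derivative_integ, mul_assoc, ← pow_add, h2]
    push_cast
    rw [add_right_comm, add_right_comm j 1 m]
  X_pow_dvd_op {A F m j} hA hm hF := by
    refine X_pow_dvd_integ ?_
    have hAm : X ^ 1 ∣ A ^ m :=
      (X_dvd_of_constantCoeff_eq_zero hA).trans (dvd_pow_self A (by omega))
    -- Differentiation costs one factor `X`, which `A ^ m` gives back because `1 ≤ m`; for `j = 0`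
    -- there is nothing to lose.
    rcases j with _ | j
    · simp
    · rw [pow_add]
      exact mul_dvd_mul (X_pow_dvd_derivative hF) hAm

/-- The `m`-th iterate of the operation `F ↦ ∫ A' F`, which appends a tree with a largest label. -/
noncomputable def appendOp (A : ℚ⟦X⟧) : ℕ → ℚ⟦X⟧ →+ ℚ⟦X⟧
  | 0 => AddMonoidHom.id _
  | m + 1 => AddMonoidHom.mk' (fun F => integ (d⁄dX ℚ A * appendOp A m F)) fun F G => by
      rw [map_add, mul_add, integ_add]

theorem appendOp_succ (A F : ℚ⟦X⟧) (m : ℕ) :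
    appendOp A (m + 1) F = integ (d⁄dX ℚ A * appendOp A m F) := rfl

/-- The largest labels increase from left to right. -/
noncomputable def increasingSiblings :
    SiblingOrder fun c => c.Pairwise fun S S' => S.maxLabel < S'.maxLabel where
  coef j := (j.factorial : ℚ)⁻¹
  coef_one := by simp
  op A m := appendOp A m
  hasEGF {𝓐 𝓕 A F} h𝓐 h𝓕 hA hF m := by
    induction m with
    | zero =>
      refine hF.bijOn (fun T => [T]) (fun S => ⟨?_, ?_, ?_⟩) ?_
      · rintro T ⟨h1, h2⟩
        exact ⟨⟨T, [], by simp [h1]⟩, by simpa [listLabels, labels] using h2⟩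
      · rintro T - T' - h
        simpa using h
      · rintro _ ⟨⟨T, l, rfl, h1, h2, h3, -⟩, h4⟩
        obtain rfl := List.length_eq_zero_iff.1 h3
        exact ⟨T, ⟨h1, by simpa [listLabels, labels] using h4⟩, rfl⟩
      · intro T _
        simp [listSign]
    | succ m ih =>
      -- In an increasing list the last tree carries the largest label of all, so lists are built up
      -- from the right.
      have key := hA.pointed_prod ih
        (fun z => ∃ m ∈ labels z.1, ∀ i ∈ listLabels z.2, i < m)
        (by
          rintro z ⟨m, hm, -⟩ h0
          simp [h0] at hm)
        (fun S hS => ⟨_, S.max'_mem hS, fun z _ _ hz => exists_lt_iff_max'_mem hS hz⟩)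
      rw [appendOp_succ]
      refine key.bijOn (fun z => z.2 ++ [z.1]) (fun S => ⟨?_, ?_, ?_⟩) ?_
      · rintro ⟨U, _⟩ ⟨⟨h1, ⟨T, l, rfl, h2, h3, h4, h5⟩, i, hi, hlt⟩, h6⟩
        refine ⟨⟨T, l ++ [U], rfl, h2, ?_, by simp [h4], ?_⟩, ?_⟩
        · intro V hV
          rcases List.mem_append.1 hV with hV | hV
          · exact h3 V hV
          · rw [List.mem_singleton.1 hV]
            exact h1
        · refine List.pairwise_append.2 ⟨h5, List.pairwise_singleton _ _, ?_⟩
          intro V hV W hW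
          rw [List.mem_singleton.1 hW]
          have hV' : V.labels ≠ 0 := by
            rcases List.mem_cons.1 hV with rfl | hV
            · exact h𝓕 _ h2
            · exact h𝓐 _ (h3 V hV)
          exact (hlt _ (mem_listLabels.2 ⟨V, hV, (maxLabel_spec hV').1⟩)).trans_le
            ((maxLabel_spec (h𝓐 U h1)).2 i hi)
        · exact (listLabels_concat U (T :: l)).trans h6
      · rintro ⟨T, l⟩ - ⟨T', l'⟩ - h
        have := List.append_inj' h rfl
        simp_all
      · rintro _ ⟨⟨T, l, rfl, h1, h2, h3, h5⟩, h4⟩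
        obtain ⟨l, U, rfl⟩ : ∃ l' U, l = l' ++ [U] :=
          ⟨_, _, (List.dropLast_append_getLast (by rintro rfl; simp at h3)).symm⟩
        rw [← List.cons_append, List.pairwise_append] at h5
        have hU := h2 U (by simp)
        refine ⟨(U, T :: l), ⟨⟨hU, ⟨T, l, rfl, h1, fun V hV => h2 V (by simp [hV]),
          by simpa using h3, h5.1⟩, ?_⟩, (listLabels_concat U (T :: l)).symm.trans h4⟩, rfl⟩
        refine ⟨_, (maxLabel_spec (h𝓐 U hU)).1, fun i hi => ?_⟩
        obtain ⟨V, hV, hi⟩ := mem_listLabels.1 hi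
        have hV' : V.labels ≠ 0 := fun h => by simp [h] at hi
        exact ((maxLabel_spec hV').2 i hi).trans_lt (h5.2.2 V hV U (by simp))
      · intro z _
        simp [listSign, mul_comm]
  op_pow {A} hA m j hj := by
    induction m with
    | zero => rfl
    | succ m ih =>
      rw [appendOp_succ, ih]
      refine integ_eq ?_ ?_
      · rw [smul_eq_C_mul, map_mul, map_pow, hA, ← add_assoc, pow_succ]
        simp
      · rw [Derivation.map_smul, derivative_pow, ← add_assoc, Nat.add_sub_cancel,
          Nat.factorial_succ, mul_smul_comm, Nat.cast_mul, mul_inv, mul_comm (_)⁻¹, ← smul_smul]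
        congr 1
        have : ((j + m + 1 : ℕ) : ℚ⟦X⟧) = C ((j + m + 1 : ℕ) : ℚ) := by simp
        rw [this, mul_assoc, ← smul_eq_C_mul, smul_smul, inv_mul_cancel₀ (by positivity), one_smul,
          mul_comm]
  X_pow_dvd_op {A F m j} hA hm hF := by
    obtain ⟨m, rfl⟩ : ∃ i, m = i + 1 := ⟨m - 1, by omega⟩
    have step : ∀ {G : ℚ⟦X⟧} {i : ℕ}, X ^ i ∣ G → X ^ (i + 1) ∣ integ (d⁄dX ℚ A * G) :=
      fun h => X_pow_dvd_integ (h.mul_left _)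
    clear hm
    induction m with
    | zero =>
      rw [appendOp_succ]
      exact step hF
    | succ m ih =>
      rw [appendOp_succ]
      exact step ((pow_dvd_pow X (Nat.le_succ j)).trans ih)

/-! ### Left-odd ancestry -/

namespace OTree

/-- Whether the vertex `p` of `T` has `s`-left-odd ancestry when the root has (`b = true`) or does
not have (`b = false`) `s`-left-odd ancestry. -/
def oddAt (s : ℕ) : List ℕ → Bool → OTree → Bool
  | [], b, _ => b
  | _ :: _, _, leaf _ => false
  | i :: p, b, node cs =>
    match cs[i]? with
    | none => false
    | some T => oddAt s p (decide (i = 0 ∧ cs.length = s) && !b) T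

theorem subtreeAt_nil (T : OTree) : T.subtreeAt [] = some T := by
  cases T <;> rfl

theorem subtreeAt_leaf_cons (j i : ℕ) (p : List ℕ) : (leaf j).subtreeAt (i :: p) = none := rfl

theorem subtreeAt_node_cons (cs : List OTree) (i : ℕ) (p : List ℕ) :
    (node cs).subtreeAt (i :: p) = cs[i]?.bind fun T => subtreeAt T p := rfl

theorem subtreeAt_node_cons_of_lt {cs : List OTree} {i : ℕ} (hi : i < cs.length) (p : List ℕ) :
    (node cs).subtreeAt (i :: p) = cs[i].subtreeAt p := by
  rw [subtreeAt_node_cons, List.getElem?_eq_getElem hi, Option.bind_some]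

theorem degree_nil (T : OTree) : T.degree [] = T.rootDegree := by
  rw [degree, subtreeAt_nil]
  rfl

theorem degree_leaf_cons (j i : ℕ) (p : List ℕ) : (leaf j).degree (i :: p) = 0 := rfl

theorem degree_node_cons_of_lt {cs : List OTree} {i : ℕ} (hi : i < cs.length) (p : List ℕ) :
    (node cs).degree (i :: p) = cs[i].degree p := by
  rw [degree, subtreeAt_node_cons_of_lt hi, degree]

theorem degree_node_cons_of_le {cs : List OTree} {i : ℕ} (hi : cs.length ≤ i) (p : List ℕ) :
    (node cs).degree (i :: p) = 0 := by
  rw [degree, subtreeAt_node_cons, List.getElem?_eq_none hi]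
  rfl

theorem oddAt_node_cons_of_lt {s : ℕ} {cs : List OTree} {i : ℕ} (hi : i < cs.length) (p : List ℕ)
    (b : Bool) : oddAt s (i :: p) b (node cs) =
      oddAt s p (decide (i = 0 ∧ cs.length = s) && !b) cs[i] := by
  rw [oddAt, List.getElem?_eq_getElem hi]

theorem oddAt_node_cons_of_le {s : ℕ} {cs : List OTree} {i : ℕ} (hi : cs.length ≤ i) (p : List ℕ)
    (b : Bool) : oddAt s (i :: p) b (node cs) = false := by
  rw [oddAt, List.getElem?_eq_none hi]

/-- `oddAt` reads an address from the root, while runs of left-most steps are extended at its end;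
this is the recursion at the end. `s ≠ 0` is needed because `degree` is `0` at leaves and outside
the tree. -/
theorem oddAt_concat {s : ℕ} (hs : s ≠ 0) (p : List ℕ) (i : ℕ) (b : Bool) (T : OTree) :
    oddAt s (p ++ [i]) b T = true ↔ i = 0 ∧ T.degree p = s ∧ ¬ oddAt s p b T = true := by
  induction p generalizing b T with
  | nil =>
    rw [List.nil_append, degree_nil]
    rcases T with j | cs
    · simp [oddAt, rootDegree, hs.symm]
    · rcases lt_or_ge i cs.length with hi | hi
      · rw [oddAt_node_cons_of_lt hi]
        simp [oddAt, rootDegree, and_assoc]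
      · rw [oddAt_node_cons_of_le hi]
        simp only [Bool.false_eq_true, rootDegree, false_iff]
        rintro ⟨rfl, h, -⟩
        omega
  | cons j p ih =>
    rw [List.cons_append]
    rcases T with k | cs
    · simp [oddAt, degree_leaf_cons, hs.symm]
    · rcases lt_or_ge j cs.length with hj | hj
      · rw [oddAt_node_cons_of_lt hj, oddAt_node_cons_of_lt hj, degree_node_cons_of_lt hj, ih]
      · rw [oddAt_node_cons_of_le hj, degree_node_cons_of_le hj]
        simp [hs.symm]

/-- `p` is reached from `q` by a maximal path of `m` left-most steps from vertices of degree `s`. -/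
def IsLeftRun (s : ℕ) (T : OTree) (p q : List ℕ) (m : ℕ) : Prop :=
  p = q ++ List.replicate m 0 ∧ (∀ i < m, T.degree (q ++ List.replicate i 0) = s) ∧
    ¬ ∃ w : List ℕ, q = w ++ [0] ∧ T.degree w = s

theorem isLeftRun_concat_zero {s : ℕ} {T : OTree} {p q : List ℕ} {i : ℕ} :
    IsLeftRun s T (p ++ [i]) q 0 ↔ q = p ++ [i] ∧ ¬ (i = 0 ∧ T.degree p = s) := by
  simp only [IsLeftRun, List.replicate_zero, List.append_nil, not_lt_zero, false_imp_iff,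
    implies_true, true_and, eq_comm (a := p ++ [i])]
  refine and_congr_right fun h => not_congr ?_
  subst h
  constructor
  · rintro ⟨w, h, hw⟩
    obtain ⟨rfl, h⟩ := List.append_inj' h rfl
    simp at h
    exact ⟨h, hw⟩
  · rintro ⟨rfl, h⟩
    exact ⟨p, rfl, h⟩

theorem isLeftRun_concat_succ {s : ℕ} {T : OTree} {p q : List ℕ} {i m : ℕ} :
    IsLeftRun s T (p ++ [i]) q (m + 1) ↔ i = 0 ∧ T.degree p = s ∧ IsLeftRun s T p q m := by
  simp only [IsLeftRun, List.replicate_succ', ← List.append_assoc]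
  constructor
  · rintro ⟨h1, h2, h3⟩
    obtain ⟨h4, h5⟩ := List.append_inj' h1 rfl
    simp only [List.cons.injEq, and_true] at h5
    exact ⟨h5, h4 ▸ h2 m (by omega), h4, fun i hi => h2 i (by omega), h3⟩
  · rintro ⟨rfl, h1, h2, h3, h4⟩
    refine ⟨by rw [h2], fun i hi => ?_, h4⟩
    rcases Nat.lt_succ_iff_lt_or_eq.1 hi with hi | rfl
    · exact h3 i hi
    · rw [← h2, h1]

theorem exists_isLeftRun (s : ℕ) (T : OTree) (p : List ℕ) : ∃ q m, IsLeftRun s T p q m := by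
  induction p using List.reverseRecOn with
  | nil => exact ⟨[], 0, by simp [IsLeftRun]⟩
  | append_singleton p i ih =>
    by_cases h : i = 0 ∧ T.degree p = s
    · obtain ⟨q, m, hq⟩ := ih
      exact ⟨q, m + 1, isLeftRun_concat_succ.2 ⟨h.1, h.2, hq⟩⟩
    · exact ⟨p ++ [i], 0, isLeftRun_concat_zero.2 ⟨rfl, h⟩⟩

/-- Maximality fixes the length of the run, so its parity is well defined and the absence of
left-odd ancestry means an even run. -/
theorem IsLeftRun.unique {s : ℕ} {T : OTree} {p q q' : List ℕ} {m m' : ℕ}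
    (h : IsLeftRun s T p q m) (h' : IsLeftRun s T p q' m') : m = m' := by
  induction p using List.reverseRecOn generalizing m m' with
  | nil =>
    have h1 := congrArg List.length h.1
    have h2 := congrArg List.length h'.1
    simp at h1 h2
    omega
  | append_singleton p i ih =>
    rcases m with _ | m <;> rcases m' with _ | m'
    · rfl
    · obtain ⟨h1, h2, -⟩ := isLeftRun_concat_succ.1 h'
      exact absurd ⟨h1, h2⟩ (isLeftRun_concat_zero.1 h).2
    · obtain ⟨h1, h2, -⟩ := isLeftRun_concat_succ.1 h
      exact absurd ⟨h1, h2⟩ (isLeftRun_concat_zero.1 h').2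
    · rw [ih (isLeftRun_concat_succ.1 h).2.2 (isLeftRun_concat_succ.1 h').2.2]

theorem hasLeftOddAncestry_iff {s : ℕ} {T : OTree} {p : List ℕ} :
    HasLeftOddAncestry s T p ↔ ∃ q m, Odd m ∧ IsLeftRun s T p q m := Iff.rfl

/-- Both sides obey the same recursion: a left-most step from a vertex of degree `s` lengthens the
maximal run by one and flips its parity, and any other step starts a run of length `0`. -/
theorem hasLeftOddAncestry_iff_oddAt {s : ℕ} (hs : s ≠ 0) (T : OTree) (p : List ℕ) :
    HasLeftOddAncestry s T p ↔ oddAt s p false T = true := by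
  induction p using List.reverseRecOn with
  | nil =>
    simp only [hasLeftOddAncestry_iff, oddAt, Bool.false_eq_true, iff_false]
    rintro ⟨q, m, hm, h, -⟩
    have h1 := congrArg List.length h
    simp only [List.length_nil, List.length_append, List.length_replicate] at h1
    obtain rfl : m = 0 := by omega
    simp at hm
  | append_singleton p i ih =>
    rw [oddAt_concat hs, ← ih, hasLeftOddAncestry_iff, hasLeftOddAncestry_iff]
    constructor
    · rintro ⟨q, _ | m, hm, h⟩
      · simp at hm
      · obtain ⟨h1, h2, h3⟩ := isLeftRun_concat_succ.1 h
        refine ⟨h1, h2, ?_⟩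
        rintro ⟨q', m', hm', h'⟩
        rw [← h3.unique h'] at hm'
        rw [Nat.odd_add_one] at hm
        exact hm hm'
    · rintro ⟨h1, h2, h3⟩
      obtain ⟨q, m, h⟩ := exists_isLeftRun s T p
      refine ⟨q, m + 1, ?_, isLeftRun_concat_succ.2 ⟨h1, h2, h⟩⟩
      rw [Nat.odd_add_one]
      exact fun hm => h3 ⟨q, m, hm, h⟩

/-! ### Recursive description of good trees -/

theorem forall_subtreeAt_node {cs : List OTree} {Q : List ℕ → OTree → Prop} :
    (∀ p S, (node cs).subtreeAt p = some S → Q p S) ↔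
      Q [] (node cs) ∧ ∀ i, ∀ hi : i < cs.length, ∀ p S, cs[i].subtreeAt p = some S → Q (i :: p) S := by
  constructor
  · intro h
    refine ⟨h [] _ (subtreeAt_nil _), fun i hi p S hS => h _ _ ?_⟩
    rwa [subtreeAt_node_cons_of_lt hi]
  · rintro ⟨h1, h2⟩ (_ | ⟨i, p⟩) S hS
    · rw [subtreeAt_nil, Option.some.injEq] at hS
      exact hS ▸ h1
    · rcases lt_or_ge i cs.length with hi | hi
      · rw [subtreeAt_node_cons_of_lt hi] at hS
        exact h2 i hi p S hS
      · rw [subtreeAt_node_cons, List.getElem?_eq_none hi] at hS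
        simp at hS

theorem forall_subtreeAt_leaf {j : ℕ} {Q : List ℕ → OTree → Prop} :
    (∀ p S, (leaf j).subtreeAt p = some S → Q p S) ↔ Q [] (leaf j) := by
  constructor
  · exact fun h => h [] _ (subtreeAt_nil _)
  · rintro h (_ | ⟨i, p⟩) S hS
    · rw [subtreeAt_nil, Option.some.injEq] at hS
      exact hS ▸ h
    · simp [subtreeAt_leaf_cons] at hS

theorem degree_eq {T S : OTree} {p : List ℕ} (h : T.subtreeAt p = some S) :
    T.degree p = S.rootDegree := by
  rw [degree, h]
  rfl

end OTree

/-- The phylogenetic trees with siblings ordered according to `Ord` whose non-leaf vertices with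
(without) `s`-left-odd ancestry have degrees in `D true` (`D false`), where `b` tells whether the
root is considered to have left-odd ancestry. -/
def goodTrees (Ord : List OTree → Prop) (s : ℕ) (D : Bool → Set ℕ) (b : Bool) : Set OTree :=
  {T | ∀ p S, T.subtreeAt p = some S → (∀ cs, S = node cs → 2 ≤ cs.length ∧ Ord cs) ∧
    (S.rootDegree = 0 ∨ S.rootDegree ∈ D (oddAt s p b T))}

theorem leaf_mem_goodTrees (Ord : List OTree → Prop) (s : ℕ) (D : Bool → Set ℕ) (b : Bool)
    (i : ℕ) : leaf i ∈ goodTrees Ord s D b := by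
  rw [goodTrees, Set.mem_ofPred_eq, forall_subtreeAt_leaf]
  simp [rootDegree]

/-- This is why `goodTrees` carries a flag: the ancestry of a vertex in a branch depends on the rest
of the tree only through the flag at the root of that branch. -/
theorem node_mem_goodTrees {Ord : List OTree → Prop} {s : ℕ} {D : Bool → Set ℕ} {b : Bool}
    (hD : ∀ n ∈ D b, 2 ≤ n) {cs : List OTree} :
    node cs ∈ goodTrees Ord s D b ↔ Ord cs ∧ cs.length ∈ D b ∧ ∀ i, ∀ hi : i < cs.length,
      cs[i] ∈ goodTrees Ord s D (decide (i = 0 ∧ cs.length = s) && !b) := by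
  simp only [goodTrees, Set.mem_ofPred_eq]
  rw [forall_subtreeAt_node]
  constructor
  · rintro ⟨⟨h1, h2⟩, h3⟩
    have h4 := h1 cs rfl
    refine ⟨h4.2, ?_, fun i hi p S hS => ?_⟩
    · simp only [rootDegree, oddAt] at h2
      exact h2.resolve_left (by omega)
    · have := h3 i hi p S hS
      rwa [oddAt_node_cons_of_lt hi] at this
  · rintro ⟨h1, h2, h3⟩
    refine ⟨⟨?_, Or.inr h2⟩, fun i hi p S hS => ?_⟩
    · intro cs' hc'
      obtain rfl : cs = cs' := by simpa using hc'
      exact ⟨hD _ h2, h1⟩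
    · rw [oddAt_node_cons_of_lt hi]
      exact h3 i hi p S hS

theorem labels_ne_zero_of_mem_goodTrees {Ord : List OTree → Prop} {s : ℕ} {D : Bool → Set ℕ}
    (hD : ∀ b, ∀ n ∈ D b, 2 ≤ n) {T : OTree} :
    ∀ {b : Bool}, T ∈ goodTrees Ord s D b → T.labels ≠ 0 := by
  induction T using OTree.induct with
  | leaf i => simp [labels, leaves_leaf]
  | node cs ih =>
    intro b h
    obtain ⟨-, h1, h2⟩ := (node_mem_goodTrees (hD b)).1 h
    have h0 : 0 < cs.length := by
      have := hD _ _ h1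
      omega
    intro h3
    refine ih _ (List.getElem_mem h0) (h2 0 h0) ?_
    rw [labels_node] at h3
    refine Multiset.eq_zero_of_forall_notMem fun i hi => ?_
    have := mem_listLabels.2 ⟨_, List.getElem_mem h0, hi⟩
    simp [h3] at this

theorem node_mem_goodTrees_true {Ord : List OTree → Prop} {s : ℕ} {D : Bool → Set ℕ}
    (hD : ∀ b, ∀ n ∈ D b, 2 ≤ n) {cs : List OTree} :
    node cs ∈ goodTrees Ord s D true ↔ Ord cs ∧ cs.length ∈ D true ∧
      ∀ T ∈ cs, T ∈ goodTrees Ord s D false := by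
  rw [node_mem_goodTrees (hD true)]
  simp [List.forall_mem_iff_getElem]

/-- Only a root of degree `s` passes the flag on, and only to its first branch; `s ∉ M` keeps the
two cases apart. -/
theorem node_mem_goodTrees_false {Ord : List OTree → Prop} {s : ℕ} {D : Bool → Set ℕ} {M : Set ℕ}
    (hD : ∀ b, ∀ n ∈ D b, 2 ≤ n) (hDM : D false = insert s M) (hs : s ∉ M) {cs : List OTree} :
    node cs ∈ goodTrees Ord s D false ↔
      cs ∈ treeLists Ord (goodTrees Ord s D false) (goodTrees Ord s D true) (s - 1) ∨
      Ord cs ∧ cs.length ∈ M ∧ ∀ T ∈ cs, T ∈ goodTrees Ord s D false := by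
  rw [node_mem_goodTrees (hD false), hDM, Set.mem_insert_iff]
  have hs2 : 2 ≤ s := hD false s (hDM ▸ Set.mem_insert _ _)
  constructor
  · rintro ⟨h1, h2 | h2, h3⟩
    · left
      rcases cs with _ | ⟨T, l⟩
      · simp at h2
        omega
      · refine ⟨T, l, rfl, ?_, ?_, ?_, h1⟩
        · have h := h3 0 (by simp)
          rw [show (decide (0 = 0 ∧ (T :: l).length = s) && !false) = true by
            simp [-List.length_cons, h2]] at h
          exact h
        · rw [List.forall_mem_iff_getElem]
          intro i hi
          have h := h3 (i + 1) (by simpa using hi)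
          rw [show (decide (i + 1 = 0 ∧ (T :: l).length = s) && !false) = false by simp] at h
          exact h
        · rw [← h2]
          simp
    · right
      refine ⟨h1, h2, ?_⟩
      rw [List.forall_mem_iff_getElem]
      intro i hi
      have hne : cs.length ≠ s := fun h => hs (h ▸ h2)
      simpa [hne] using h3 i hi
  · rintro (⟨T, l, rfl, h1, h2, h3, h4⟩ | ⟨h1, h2, h3⟩)
    · have hlen : (T :: l).length = s := by
        rw [List.length_cons]
        omega
      refine ⟨h4, Or.inl hlen, ?_⟩
      rintro (_ | i) hi
      · simpa [-List.length_cons, hlen] using h1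
      · simpa using h2 _ (List.getElem_mem (by simpa using hi))
    · have hne : cs.length ≠ s := fun h => hs (h ▸ h2)
      refine ⟨h1, Or.inr h2, fun i hi => ?_⟩
      simpa [hne] using h3 _ (List.getElem_mem hi)

theorem listLabels_card_and_listSign {d : ℕ} {cs : List OTree}
    (h : ∀ T ∈ cs, ∃ e, T.labels.card = 1 + d * e ∧ T.sign = (-1) ^ e) :
    ∃ e, (listLabels cs).card = cs.length + d * e ∧ listSign cs = (-1) ^ e := by
  induction cs with
  | nil => exact ⟨0, by simp [listLabels], by simp [listSign]⟩
  | cons T cs ih =>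
    obtain ⟨e, h1, h2⟩ := ih fun S hS => h S (by simp [hS])
    obtain ⟨e', h3, h4⟩ := h T (by simp)
    refine ⟨e' + e, ?_, ?_⟩
    · rw [listLabels_cons, Multiset.card_add, h1, h3, List.length_cons]
      ring
    · rw [pow_add, ← h2, ← h4]
      simp [listSign]

/-- The number of leaves of a good tree determines its sign. -/
theorem card_labels_and_sign_of_mem_goodTrees {Ord : List OTree → Prop} {s d : ℕ}
    {D : Bool → Set ℕ} (hD : ∀ b, ∀ n ∈ D b, 2 ≤ n)
    (hDe : ∀ b, ∀ n ∈ D b, ∃ r, Odd r ∧ n = d * r + 1) {T : OTree} :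
    ∀ {b : Bool}, T ∈ goodTrees Ord s D b →
      ∃ e, T.labels.card = 1 + d * e ∧ T.sign = (-1) ^ e := by
  induction T using OTree.induct with
  | leaf i => exact fun _ => ⟨0, by simp [labels, leaves_leaf], by simp [sign_leaf]⟩
  | node cs ih =>
    intro b h
    obtain ⟨-, h1, h2⟩ := (node_mem_goodTrees (hD b)).1 h
    obtain ⟨r, hr, hn⟩ := hDe _ _ h1
    obtain ⟨e, h3, h4⟩ := listLabels_card_and_listSign (d := d) (cs := cs) (by
      intro T hT
      obtain ⟨i, hi, rfl⟩ := List.mem_iff_getElem.1 hT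
      exact ih _ (List.getElem_mem hi) (h2 i hi))
    -- The root raises the exponent by the odd number `r`, in agreement with its own factor `-1`.
    refine ⟨r + e, ?_, ?_⟩
    · rw [labels_node, h3, hn]
      ring
    · rw [sign_node, h4, pow_add, hr.neg_one_pow]
      ring

/-! ### Generating functions of good trees -/

open Classical in
/-- The power series with coefficients `φ m` at the exponents `m ∈ M` and `0` elsewhere. -/
noncomputable def coefSeries (φ : ℕ → ℚ) (M : Set ℕ) : ℚ⟦X⟧ :=
  PowerSeries.mk fun m => if m ∈ M then φ m else 0

theorem coeff_pow_eq_zero {A : ℚ⟦X⟧} (hA : constantCoeff A = 0) {n m : ℕ} (h : n < m) :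
    coeff n (A ^ m) = 0 :=
  X_pow_dvd_iff.1 (pow_dvd_pow_of_dvd (X_dvd_iff.2 hA) m) n h

/-- Terms with `m > n` vanish. The free bound `N` allows one truncation for several coefficients. -/
theorem coeff_subst_eq_sum {A : ℚ⟦X⟧} (hA : constantCoeff A = 0) (f : ℚ⟦X⟧) {n N : ℕ} (h : n ≤ N) :
    coeff n (f.subst A) = ∑ m ∈ Finset.range (N + 1), coeff m f * coeff n (A ^ m) := by
  rw [coeff_subst' (HasSubst.of_constantCoeff_zero' hA)]
  simp only [smul_eq_mul]
  refine finsum_eq_sum_of_support_subset _ fun m hm => ?_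
  rw [Finset.coe_range, Set.mem_Iio]
  by_contra hlt
  refine hm ?_
  beta_reduce
  rw [coeff_pow_eq_zero hA (by omega), mul_zero]

open Classical in
theorem coeff_subst_coefSeries {A : ℚ⟦X⟧} (hA : constantCoeff A = 0) (φ : ℕ → ℚ) (M : Set ℕ)
    {n N : ℕ} (h : n ≤ N) : coeff n ((coefSeries φ M).subst A) =
      ∑ m ∈ Finset.range (N + 1), if m ∈ M then coeff n (φ m • A ^ m) else 0 := by
  rw [coeff_subst_eq_sum hA _ h]
  refine Finset.sum_congr rfl fun m _ => ?_
  rw [coefSeries, coeff_mk, map_smul, smul_eq_mul]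
  split_ifs <;> simp

theorem HasEGF.constantCoeff_eq_zero {ι α : Type*} {la : α → Multiset ι} {X : Set α} {w : α → ℚ}
    {G : ℚ⟦X⟧} (h : HasEGF la X w G) (hX : ∀ x ∈ X, la x ≠ 0) : constantCoeff G = 0 := by
  obtain ⟨t, ht, hs⟩ := h ∅
  have : t = ∅ := Finset.eq_empty_of_forall_notMem fun x hx =>
    hX x ((ht x).1 hx).1 ((ht x).1 hx).2
  rw [this] at hs
  simpa using hs.symm

/-- The lists of trees from `𝓐` satisfying `Ord`, with lengths in `M`. -/
def fullLists (Ord : List OTree → Prop) (𝓐 : Set OTree) (M : Set ℕ) : Set (List OTree) :=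
  {l | (Ord l ∧ ∀ T ∈ l, T ∈ 𝓐) ∧ l.length ∈ M}

theorem length_le_card_listLabels {l : List OTree} (h : ∀ T ∈ l, T.labels ≠ 0) :
    l.length ≤ (listLabels l).card := by
  induction l with
  | nil => simp
  | cons T l ih =>
    rw [listLabels_cons, Multiset.card_add, List.length_cons, add_comm]
    exact Nat.add_le_add (Multiset.card_pos.2 (h T (by simp))) (ih fun S hS => h S (by simp [hS]))

/-- A list of `m + 1` trees from `𝓐` is a first tree followed by `m` others, and `op_pow` at `j = 1`
evaluates `op A m A`. -/
theorem SiblingOrder.hasEGF_fullLists {Ord : List OTree → Prop} (O : SiblingOrder Ord)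
    {𝓐 : Set OTree} {A : ℚ⟦X⟧} (h𝓐 : ∀ T ∈ 𝓐, T.labels ≠ 0) (hA : HasEGF labels 𝓐 sign A)
    {M : Set ℕ} (hM : 0 ∉ M) :
    HasEGF listLabels (fullLists Ord 𝓐 M) listSign ((coefSeries O.coef M).subst A) := by
  classical
  have hA0 := hA.constantCoeff_eq_zero h𝓐
  refine HasEGF.sum_degrees (X := {l | Ord l ∧ ∀ T ∈ l, T ∈ 𝓐}) List.length
    (G := fun m => O.coef m • A ^ m) M
    (fun l hl => length_le_card_listLabels fun T hT => h𝓐 T (hl.2 T hT)) (fun m hm => ?_)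
    (fun n => ?_)
  · obtain ⟨m, rfl⟩ : ∃ i, m = i + 1 :=
      ⟨m - 1, by have : m ≠ 0 := fun h => hM (h ▸ hm); omega⟩
    have h1 := O.op_pow hA0 m 1 le_rfl
    rw [O.coef_one, one_smul, pow_one, add_comm 1 m] at h1
    have h2 := O.hasEGF h𝓐 h𝓐 hA hA m
    rw [h1] at h2
    refine h2.congr fun l _ => ?_
    constructor
    · rintro ⟨T, l, rfl, h1, h2, h3, h4⟩
      exact ⟨⟨h4, by simpa using ⟨h1, h2⟩⟩, by simp [h3]⟩
    · rintro ⟨⟨h1, h2⟩, h3⟩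
      obtain ⟨T, l, rfl⟩ := List.exists_cons_of_length_eq_add_one h3
      exact ⟨T, l, rfl, h2 T (by simp), fun S hS => h2 S (by simp [hS]), by simpa using h3, h1⟩
  · rw [coeff_subst_coefSeries hA0 _ _ le_rfl]

/-- The isolated leaves, and the trees whose list of branches at the root is in `C`. -/
def planted (C : Set (List OTree)) : Set OTree := Set.range leaf ∪ node '' C

theorem hasEGF_range_leaf : HasEGF labels (Set.range leaf) sign X := by
  intro S
  by_cases hS : S.card = 1
  · obtain ⟨i, rfl⟩ := Finset.card_eq_one.1 hS
    refine ⟨{leaf i}, fun T => ?_, by simp [sign_leaf]⟩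
    rw [Finset.mem_singleton]
    constructor
    · rintro rfl
      exact ⟨⟨i, rfl⟩, by simp [labels, leaves_leaf]⟩
    · rintro ⟨⟨j, rfl⟩, h⟩
      have : j = i := by simpa [labels, leaves_leaf] using h
      rw [this]
  · refine ⟨∅, fun T => ?_, by simp [coeff_X, hS]⟩
    simp only [Finset.notMem_empty, false_iff]
    rintro ⟨⟨j, rfl⟩, h⟩
    have := congrArg Multiset.card h
    simp [labels, leaves_leaf] at this
    exact hS this.symm

/-- The new root contributes the factor `-1`, hence the minus sign in front of `G`. -/
theorem HasEGF.planted {C : Set (List OTree)} {G : ℚ⟦X⟧} (h : HasEGF listLabels C listSign G) :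
    HasEGF labels (planted C) sign (X - G) := by
  rw [sub_eq_add_neg]
  refine hasEGF_range_leaf.union ?_ ?_
  · refine (h.neg (v := fun c => -listSign c) fun _ _ => rfl).bijOn node (fun S => ⟨?_, ?_, ?_⟩) ?_
    · rintro c ⟨h1, h2⟩
      exact ⟨⟨c, h1, rfl⟩, by rw [labels_node, h2]⟩
    · rintro c - c' - h
      simpa using h
    · rintro _ ⟨⟨c, h1, rfl⟩, h2⟩
      exact ⟨c, ⟨h1, by rw [← h2, labels_node]⟩, rfl⟩
    · exact fun c _ => sign_node c
  · rw [Set.disjoint_left]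
    rintro _ ⟨i, rfl⟩ ⟨c, -, h⟩
    simp at h

theorem card_labels_lt {c : List OTree} (h : ∀ T ∈ c, T.labels ≠ 0) (hc : 2 ≤ c.length)
    {T : OTree} (hT : T ∈ c) : T.labels.card < (listLabels c).card := by
  obtain ⟨l, l', rfl⟩ := List.append_of_mem hT
  have h1 : (listLabels (l ++ T :: l')).card =
      T.labels.card + ((listLabels l).card + (listLabels l').card) := by
    simp [listLabels, labels]
    omega
  have h2 := length_le_card_listLabels fun S hS => h S (List.mem_append_left _ hS)
  have h3 := length_le_card_listLabels fun S hS =>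
    h S (List.mem_append_right _ (List.mem_cons_of_mem _ hS))
  simp only [List.length_append, List.length_cons] at hc
  omega

/-! ### Decomposition of good trees at the root. -/

section

variable {Ord : List OTree → Prop} (O : SiblingOrder Ord) {d : ℕ} {D : Bool → Set ℕ} {M : Set ℕ}
  (hD : ∀ b, ∀ n ∈ D b, 2 ≤ n) (hDM : D false = insert (d + 1) M) (hdM : d + 1 ∉ M)

include hD hDM in
theorem zero_notMem : 0 ∉ M ∧ 0 ∉ D true := by
  refine ⟨fun h => ?_, fun h => ?_⟩
  · have := hD false 0 (hDM ▸ Set.mem_insert_of_mem _ h)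
    omega
  · have := hD true 0 h
    omega

include O hD hDM hdM in
/-- Passing from generating functions of two classes of trees to those of the trees that have
branches in these classes. -/
theorem hasEGF_planted_step {𝓐 𝓑 : Set OTree} {A B : ℚ⟦X⟧} (h𝓐 : ∀ T ∈ 𝓐, T.labels ≠ 0)
    (h𝓑 : ∀ T ∈ 𝓑, T.labels ≠ 0) (hA : HasEGF labels 𝓐 sign A) (hB : HasEGF labels 𝓑 sign B) :
    HasEGF labels (planted (treeLists Ord 𝓐 𝓑 d ∪ fullLists Ord 𝓐 M)) sign
      (X - (O.op A d B + (coefSeries O.coef M).subst A)) ∧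
    HasEGF labels (planted (fullLists Ord 𝓐 (D true))) sign
      (X - (coefSeries O.coef (D true)).subst A) := by
  obtain ⟨hM, hD1⟩ := zero_notMem hD hDM
  refine ⟨((O.hasEGF h𝓐 h𝓑 hA hB d).union (O.hasEGF_fullLists h𝓐 hA hM) ?_).planted,
    (O.hasEGF_fullLists h𝓐 hA hD1).planted⟩
  rw [Set.disjoint_left]
  rintro _ ⟨T, l, rfl, -, -, h, -⟩ ⟨-, h'⟩
  rw [List.length_cons, h] at h'
  exact hdM h'

include hD hDM hdM in
theorem goodTrees_eq_planted :
    goodTrees Ord (d + 1) D false = planted (treeLists Ord (goodTrees Ord (d + 1) D false)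
      (goodTrees Ord (d + 1) D true) d ∪ fullLists Ord (goodTrees Ord (d + 1) D false) M) ∧
    goodTrees Ord (d + 1) D true =
      planted (fullLists Ord (goodTrees Ord (d + 1) D false) (D true)) := by
  refine ⟨Set.ext fun T => ?_, Set.ext fun T => ?_⟩
  · rcases T with i | c
    · simp [leaf_mem_goodTrees, planted]
    · rw [node_mem_goodTrees_false hD hDM hdM]
      simp [planted, fullLists, and_assoc, and_comm (a := c.length ∈ M)]
  · rcases T with i | c
    · simp [leaf_mem_goodTrees, planted]
    · rw [node_mem_goodTrees_true hD]
      simp [planted, fullLists, and_assoc, and_comm (a := c.length ∈ D true)]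

include O hD hDM hdM in
-- Finiteness of the fibers has to be established before any functional equation. Branches have
-- fewer labels than the whole tree, so the trees with fewer than `N + 1` labels are planted from
-- those with fewer than `N`.
theorem exists_hasEGF_goodTrees_lt (N : ℕ) : ∀ b, ∃ G : ℚ⟦X⟧,
    HasEGF labels {T | T ∈ goodTrees Ord (d + 1) D b ∧ T.labels.card < N} sign G := by
  induction N with
  | zero => exact fun b => ⟨0, (HasEGF.empty _ _).congr fun T _ => by simp⟩
  | succ N ih =>
    obtain ⟨A, hA⟩ := ih false
    obtain ⟨B, hB⟩ := ih true
    have hne : ∀ b, ∀ T ∈ {T | T ∈ goodTrees Ord (d + 1) D b ∧ T.labels.card < N},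
        T.labels ≠ 0 := fun b T hT => labels_ne_zero_of_mem_goodTrees hD hT.1
    obtain ⟨h1, h2⟩ := hasEGF_planted_step O hD hDM hdM (hne false) (hne true) hA hB
    obtain ⟨e1, e2⟩ := goodTrees_eq_planted (Ord := Ord) hD hDM hdM
    have hlt : ∀ {b : Bool} {c : List OTree}, node c ∈ goodTrees Ord (d + 1) D b →
        (node c).labels.card < N + 1 → ∀ T ∈ c, T.labels.card < N := by
      intro b c hc hN T hT
      obtain ⟨-, h3, h4⟩ := (node_mem_goodTrees (hD b)).1 hc
      have := card_labels_lt (c := c) (fun S hS => by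
        obtain ⟨i, hi, rfl⟩ := List.mem_iff_getElem.1 hS
        exact labels_ne_zero_of_mem_goodTrees hD (h4 i hi)) (hD b _ h3) hT
      rw [labels_node] at hN
      omega
    rintro (_ | _)
    · refine ⟨_, (h1.restrict (· < N + 1)).congr fun T _ => ?_⟩
      simp only [Set.mem_ofPred_eq]
      refine and_congr_left fun hT => ?_
      constructor
      · rintro (h | ⟨c, ⟨T, l, rfl, h1, h2, h3⟩ | ⟨⟨h1, h2⟩, h3⟩, rfl⟩) <;> rw [e1]
        · exact Or.inl h
        · exact Or.inr ⟨_, Or.inl ⟨T, l, rfl, h1.1, fun S hS => (h2 S hS).1, h3⟩, rfl⟩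
        · exact Or.inr ⟨c, Or.inr ⟨⟨h1, fun S hS => (h2 S hS).1⟩, h3⟩, rfl⟩
      · intro h
        have h' := h
        rw [e1] at h
        rcases h with h | ⟨c, ⟨T, l, rfl, h1, h2, h3⟩ | ⟨⟨h1, h2⟩, h3⟩, rfl⟩
        · exact Or.inl h
        · exact Or.inr ⟨_, Or.inl ⟨T, l, rfl, ⟨h1, hlt h' hT T (by simp)⟩,
            fun S hS => ⟨h2 S hS, hlt h' hT S (by simp [hS])⟩, h3⟩, rfl⟩
        · exact Or.inr ⟨c, Or.inr ⟨⟨h1, fun S hS => ⟨h2 S hS, hlt h' hT S hS⟩⟩, h3⟩, rfl⟩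
    · refine ⟨_, (h2.restrict (· < N + 1)).congr fun T _ => ?_⟩
      simp only [Set.mem_ofPred_eq]
      refine and_congr_left fun hT => ?_
      constructor
      · rintro (h | ⟨c, ⟨⟨h1, h2⟩, h3⟩, rfl⟩) <;> rw [e2]
        · exact Or.inl h
        · exact Or.inr ⟨c, ⟨⟨h1, fun S hS => (h2 S hS).1⟩, h3⟩, rfl⟩
      · intro h
        have h' := h
        rw [e2] at h
        rcases h with h | ⟨c, ⟨⟨h1, h2⟩, h3⟩, rfl⟩
        · exact Or.inl h
        · exact Or.inr ⟨c, ⟨⟨h1, fun S hS => ⟨h2 S hS, hlt h' hT S hS⟩⟩, h3⟩, rfl⟩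

include O hD hDM hdM in
theorem exists_hasEGF_goodTrees (b : Bool) :
    ∃ G : ℚ⟦X⟧, HasEGF labels (goodTrees Ord (d + 1) D b) sign G := by
  choose G hG using fun N => exists_hasEGF_goodTrees_lt O hD hDM hdM N b
  -- Trees with `n` labels are all present at stage `n + 1`.
  refine ⟨PowerSeries.mk fun n => coeff n (G (n + 1)), fun S => ?_⟩
  obtain ⟨t, ht, hs⟩ := hG (S.card + 1) S
  refine ⟨t, fun T => ?_, by rw [hs, coeff_mk]⟩
  rw [ht]
  constructor
  · rintro ⟨h1, h2⟩
    exact ⟨h1.1, h2⟩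
  · rintro ⟨h1, h2⟩
    exact ⟨⟨h1, by rw [h2]; exact Nat.lt_succ_self _⟩, h2⟩

include hD hDM hdM in
/-- The functional equations of the generating functions of good trees. -/
theorem goodTrees_equations : ∃ A B : ℚ⟦X⟧,
    HasEGF labels (goodTrees Ord (d + 1) D false) sign A ∧ constantCoeff A = 0 ∧
    A = X - (O.op A d B + (coefSeries O.coef M).subst A) ∧
    B = X - (coefSeries O.coef (D true)).subst A := by
  obtain ⟨A, hA⟩ := exists_hasEGF_goodTrees O hD hDM hdM false
  obtain ⟨B, hB⟩ := exists_hasEGF_goodTrees O hD hDM hdM true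
  have hne : ∀ b, ∀ T ∈ goodTrees Ord (d + 1) D b, T.labels ≠ 0 :=
    fun b T hT => labels_ne_zero_of_mem_goodTrees hD hT
  obtain ⟨h1, h2⟩ := hasEGF_planted_step O hD hDM hdM (hne false) (hne true) hA hB
  obtain ⟨e1, e2⟩ := goodTrees_eq_planted (Ord := Ord) hD hDM hdM
  rw [← e1] at h1
  rw [← e2] at h2
  exact ⟨A, B, hA, hA.constantCoeff_eq_zero (hne false), hA.unique h1, hB.unique h2⟩

end

/-! ### Inversion of the generating functions -/

/-- Termwise this is `op_pow`, but `op A d` is only additive. So the series is cut to a finite sum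
that agrees with it modulo `X ^ n`; since `op A d` raises orders, coefficient `n` of the image is
not affected. -/
theorem SiblingOrder.op_subst {Ord : List OTree → Prop} (O : SiblingOrder Ord) {A : ℚ⟦X⟧}
    (hA : constantCoeff A = 0) {d : ℕ} (hd : 1 ≤ d) {M : Set ℕ} (hM : 0 ∉ M) :
    O.op A d ((coefSeries O.coef M).subst A) = (coefSeries O.coef ((· + d) '' M)).subst A := by
  classical
  ext n
  set f := (coefSeries O.coef M).subst A
  let T : ℚ⟦X⟧ := ∑ m ∈ Finset.range (n + 1), if m ∈ M then O.coef m • A ^ m else 0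
  have hdvd : X ^ n ∣ f - T := by
    rw [X_pow_dvd_iff]
    intro i hi
    rw [map_sub, coeff_subst_coefSeries hA _ _ hi.le, map_sum, sub_eq_zero]
    refine Finset.sum_congr rfl fun m _ => ?_
    split_ifs <;> simp
  have h1 : coeff n (O.op A d f) = coeff n (O.op A d T) := by
    rw [← sub_eq_zero, ← map_sub, ← map_sub]
    exact X_pow_dvd_iff.1 (O.X_pow_dvd_op hA hd hdvd) n (Nat.lt_succ_self n)
  -- The right side is truncated at `d + n`, so that its terms beyond the first `d`, which vanish,
  -- match those of `T`.
  rw [h1, coeff_subst_coefSeries hA _ _ (Nat.le_add_left n d), add_assoc, Finset.sum_range_add,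
    Finset.sum_eq_zero, zero_add, map_sum, map_sum]
  · refine Finset.sum_congr rfl fun m _ => ?_
    have hiff : d + m ∈ (· + d) '' M ↔ m ∈ M := by
      simp [add_comm d]
    rw [if_congr hiff rfl rfl]
    split_ifs with hm
    · rw [O.op_pow hA _ _ (Nat.one_le_iff_ne_zero.2 fun h => hM (h ▸ hm)), add_comm]
    · simp
  · intro m hm
    refine if_neg ?_
    rintro ⟨i, -, rfl⟩
    exact absurd (Finset.mem_range.1 hm) (Nat.not_lt.2 (Nat.le_add_left d i))

theorem coefSeries_singleton_one {φ : ℕ → ℚ} (h : φ 1 = 1) : coefSeries φ {1} = X := by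
  ext n
  rw [coefSeries, coeff_mk, coeff_X]
  by_cases hn : n = 1 <;> simp [hn, h]

/-- The functional equations of the generating function of good trees make it a compositional
inverse of the generating function of the sets of sizes `R`. -/
theorem SiblingOrder.subst_eq_X {Ord : List OTree → Prop} (O : SiblingOrder Ord) {d : ℕ}
    (hd : 1 ≤ d) {A B : ℚ⟦X⟧} (hA : constantCoeff A = 0) {R M N : Set ℕ} (hR : 0 ∉ R) (hN : 0 ∉ N)
    (hAeq : A = X - (O.op A d B + (coefSeries O.coef M).subst A))
    (hBeq : B = X - (coefSeries O.coef N).subst A)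
    (h : coefSeries O.coef R + coefSeries O.coef ((· + d) '' N) =
      coefSeries O.coef ((· + d) '' R) + X + coefSeries O.coef M) :
    (coefSeries O.coef R).subst A = X := by
  have hs := HasSubst.of_constantCoeff_zero' hA
  have h' := congrArg (subst A) h
  rw [subst_add hs, subst_add hs, subst_add hs, subst_X hs, ← O.op_subst hA hd hR,
    ← O.op_subst hA hd hN] at h'
  rw [hBeq, map_sub] at hAeq
  set D := (coefSeries O.coef R).subst A - X with hD
  -- In `h'` the shifts by `d` have become `op A d`; eliminating `A` by its equation cancels
  -- everything except `D` and its image.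
  have key : D = O.op A d D := by
    rw [hD, map_sub]
    linear_combination h' + hAeq
  have hdvd : ∀ j, X ^ j ∣ D := by
    intro j
    induction j with
    | zero => simp
    | succ j ih =>
      rw [key]
      exact O.X_pow_dvd_op hA hd ih
  have h0 : D = 0 := by
    ext n
    exact X_pow_dvd_iff.1 (hdvd (n + 1)) n (Nat.lt_succ_self n)
  exact sub_eq_zero.1 (hD.symm.trans h0)

/-! ### Stretched sets and the endpoint identity. -/

theorem stretch_succ (d r : ℕ) : stretch d (r + 1) = d * r + 1 := rfl

/-- `0` must be excluded: truncated subtraction gives `stretch d 0 = stretch d 1`. -/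
theorem mem_image_stretch {d : ℕ} (hd : 1 ≤ d) {S : Set ℕ} (hS : 0 ∉ S) {r : ℕ} :
    stretch d (r + 1) ∈ stretch d '' S ↔ r + 1 ∈ S := by
  refine ⟨?_, Set.mem_image_of_mem _⟩
  rintro ⟨_ | i, hi, h⟩
  · exact absurd hi hS
  · rw [stretch_succ, stretch_succ, Nat.add_right_cancel_iff] at h
    rwa [← Nat.eq_of_mul_eq_mul_left hd h]

theorem image_add_image_stretch {d : ℕ} {S : Set ℕ} (hS : 0 ∉ S) :
    (· + d) '' (stretch d '' S) = stretch d '' ((· + 1) '' S) := by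
  rw [Set.image_image, Set.image_image]
  refine Set.image_congr fun r hr => ?_
  obtain ⟨r, rfl⟩ : ∃ i, r = i + 1 := ⟨r - 1, by have : r ≠ 0 := fun h => hS (h ▸ hr); omega⟩
  rw [stretch_succ, stretch_succ, mul_add]
  ring

/-- For `n ≥ 2`, passing from `n - 1` to `n` enters `R` exactly when `n ∈ a(R)` and leaves it
exactly when `n - 1 ∈ b(R)`; the term `X` accounts for `1 ∈ R`. Stretching turns the shift by `1`
into a shift by `d`. -/
theorem coefSeries_stretch {R : Set ℕ} (hpos : 0 ∉ R) (hone : 1 ∈ R) {d : ℕ} (hd : 1 ≤ d)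
    {φ : ℕ → ℚ} (hφ : φ 1 = 1) :
    coefSeries φ (stretchSet R d) + coefSeries φ ((· + d) '' (stretch d '' rightEndpoints R)) =
      coefSeries φ ((· + d) '' stretchSet R d) + X +
        coefSeries φ (stretch d '' leftEndpoints R) := by
  classical
  have hl : 0 ∉ leftEndpoints R := fun h => hpos h.1
  have hr : 0 ∉ rightEndpoints R := fun h => hpos h.1
  have h1 : {1} = stretch d '' {1} := by simp [stretch]
  rw [← coefSeries_singleton_one hφ, stretchSet, image_add_image_stretch hpos,
    image_add_image_stretch hr, h1]
  ext m
  simp only [map_add, coefSeries, coeff_mk]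
  by_cases hm : ∃ r, m = stretch d (r + 1)
  · obtain ⟨r, rfl⟩ := hm
    simp only [mem_image_stretch hd hpos, mem_image_stretch hd hl,
      mem_image_stretch hd (S := (· + 1) '' rightEndpoints R) (by simp),
      mem_image_stretch hd (S := (· + 1) '' R) (by simp),
      mem_image_stretch hd (S := {1}) (by simp)]
    rcases r with _ | r
    · simp [hone, hpos, leftEndpoints, rightEndpoints]
    · by_cases h2 : r + 1 ∈ R <;> by_cases h3 : r + 1 + 1 ∈ R <;>
        simp [h2, h3, leftEndpoints, rightEndpoints]
  · have key : ∀ S : Set ℕ, 0 ∉ S → m ∉ stretch d '' S := by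
      rintro S hS ⟨_ | r, hr, rfl⟩
      · exact hS hr
      · exact hm ⟨r, rfl⟩
    rw [if_neg (key _ hpos), if_neg (key _ hl), if_neg (key _ (by simp)), if_neg (key _ (by simp)),
      if_neg (key _ (by simp)), add_zero, add_zero]

/-! ### Matrices of powers of a power series -/

/-- The matrix with entries `n! [x ^ n] F ^ k / k!`. -/
noncomputable def bellMatrix (F : ℚ⟦X⟧) : Matrix ℕ+ ℕ+ ℚ := fun n k =>
  ((n : ℕ).factorial : ℚ) * coeff (n : ℕ) (((k : ℕ).factorial : ℚ)⁻¹ • F ^ (k : ℕ))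

/-- All entries above the diagonal vanish. -/
def IsLowerTriangular (A : Matrix ℕ+ ℕ+ ℚ) : Prop := ∀ n k, n < k → A n k = 0

theorem isLowerTriangular_bellMatrix {F : ℚ⟦X⟧} (hF : constantCoeff F = 0) :
    IsLowerTriangular (bellMatrix F) := by
  intro n k h
  rw [bellMatrix, map_smul, coeff_pow_eq_zero hF (by exact_mod_cast h), smul_zero, mul_zero]

/-- Allowing any `N ≥ n` gives all rows up to `N` a common summation range, so finite sums can be
nested. -/
theorem isMatrixProduct_iff {A B C : Matrix ℕ+ ℕ+ ℚ} (hA : IsLowerTriangular A) :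
    IsMatrixProduct A B C ↔ ∀ N n k, n ≤ N → ∑ j ∈ Finset.Icc 1 N, A n j * B j k = C n k := by
  have hsub : ∀ N n k, n ≤ N → (Function.support fun j => A n j * B j k) ⊆
      (Finset.Icc 1 N : Finset ℕ+) := by
    intro N n k hN j hj
    rw [Finset.mem_coe, Finset.mem_Icc]
    refine ⟨one_le, le_of_not_gt fun h => hj ?_⟩
    beta_reduce
    rw [hA n j (hN.trans_lt h), zero_mul]
  constructor
  · intro h N n k hN
    rw [← (h n k).2, finsum_eq_sum_of_support_subset _ (hsub N n k hN)]
  · intro h n k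
    refine ⟨(Finset.finite_toSet _).subset (hsub n n k le_rfl), ?_⟩
    rw [finsum_eq_sum_of_support_subset _ (hsub n n k le_rfl), h n n k le_rfl]

/-- Associativity `(C A) B = C (A B)`, on sums truncated at row `n`. `B` need not be triangular, so
uniqueness holds among all matrices. -/
theorem IsMatrixProduct.eq_of_left_inverse {A B C : Matrix ℕ+ ℕ+ ℚ} (hA : IsLowerTriangular A)
    (hC : IsLowerTriangular C) (hCA : IsMatrixProduct C A 1) (hAB : IsMatrixProduct A B 1) :
    B = C := by
  rw [isMatrixProduct_iff hC] at hCA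
  rw [isMatrixProduct_iff hA] at hAB
  ext n k
  have h1 : ∑ j ∈ Finset.Icc 1 n, (∑ i ∈ Finset.Icc 1 n, C n i * A i j) * B j k = B n k := by
    rw [Finset.sum_congr rfl fun j _ => by rw [hCA n n j le_rfl, Matrix.one_apply]]
    simp
  have h2 : ∑ i ∈ Finset.Icc 1 n, C n i * ∑ j ∈ Finset.Icc 1 n, A i j * B j k = C n k := by
    rw [Finset.sum_congr rfl fun i hi => by
      rw [hAB n i k (Finset.mem_Icc.1 hi).2, Matrix.one_apply]]
    simp only [mul_ite, mul_one, mul_zero, Finset.sum_ite_eq', Finset.mem_Icc, one_le,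
      true_and]
    split_ifs with h
    · rfl
    · exact (hC n k (not_le.1 h)).symm
  rw [← h1, ← h2]
  simp only [Finset.sum_mul, Finset.mul_sum, mul_assoc]
  rw [Finset.sum_comm]

theorem sum_Icc_pnat (n : ℕ+) (g : ℕ → ℚ) (hg : g 0 = 0) :
    ∑ j ∈ Finset.Icc 1 n, g j = ∑ j ∈ Finset.range (n + 1), g j := by
  rw [Finset.sum_range_succ', hg, add_zero]
  refine Finset.sum_nbij' PNat.natPred Nat.succPNat ?_ ?_ ?_ ?_ ?_
  · intro j hj
    have h1 : (j : ℕ) ≤ n := by exact_mod_cast (Finset.mem_Icc.1 hj).2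
    have h2 := PNat.natPred_add_one j
    rw [Finset.mem_range]
    omega
  · intro j hj
    rw [Finset.mem_Icc, ← PNat.coe_le_coe, ← PNat.coe_le_coe, Nat.succPNat_coe]
    have := Finset.mem_range.1 hj
    simp
    omega
  · simp
  · simp
  · intro j _
    rw [PNat.natPred_add_one]

/-- The factors `j!` cancel, and the sum over `j` is coefficient `n` of `F(G)^k = X^k`. -/
theorem isMatrixProduct_bellMatrix {F G : ℚ⟦X⟧} (hF : constantCoeff F = 0)
    (hG : constantCoeff G = 0) (h : F.subst G = X) :
    IsMatrixProduct (bellMatrix G) (bellMatrix F) 1 := by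
  rw [isMatrixProduct_iff (isLowerTriangular_bellMatrix hG)]
  intro N n k hN
  have hk : (k : ℕ) ≠ 0 := k.ne_zero
  have key := coeff_subst_eq_sum hG (F ^ (k : ℕ)) (show (n : ℕ) ≤ N by exact_mod_cast hN)
  rw [subst_pow (HasSubst.of_constantCoeff_zero' hG), h, coeff_X_pow] at key
  have : ∀ j : ℕ+, bellMatrix G n j * bellMatrix F j k =
      ((n : ℕ).factorial : ℚ) * ((k : ℕ).factorial : ℚ)⁻¹ *
        (coeff (j : ℕ) (F ^ (k : ℕ)) * coeff (n : ℕ) (G ^ (j : ℕ))) := by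
    intro j
    simp only [bellMatrix, map_smul, smul_eq_mul]
    have : ((j : ℕ).factorial : ℚ) ≠ 0 := by positivity
    field_simp
  rw [Finset.sum_congr rfl fun j _ => this j, ← Finset.mul_sum,
    sum_Icc_pnat N (fun j => coeff j (F ^ (k : ℕ)) * coeff (n : ℕ) (G ^ j))
      (by simp [hF, hk]), ← key, Matrix.one_apply]
  by_cases hnk : n = k
  · subst hnk
    rw [if_pos rfl, if_pos rfl, mul_one]
    exact mul_inv_cancel₀ (by positivity)
  · rw [if_neg hnk, if_neg (by exact_mod_cast hnk), mul_zero]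

/-- The matrices of compositionally inverse power series are inverse, and there is no other
inverse. -/
theorem isInverseMatrix_bellMatrix_iff {F G : ℚ⟦X⟧} (hF : constantCoeff F = 0)
    (hF1 : coeff 1 F = 1) (hG : constantCoeff G = 0) (h : F.subst G = X) (B : Matrix ℕ+ ℕ+ ℚ) :
    IsInverseMatrix (bellMatrix F) B ↔ B = bellMatrix G := by
  have hsF := HasSubst.of_constantCoeff_zero' hF
  have hsG := HasSubst.of_constantCoeff_zero' hG
  have hu : IsUnit (coeff 1 F) := by rw [hF1]; exact isUnit_one
  have hinv : (F.substInvOfIsUnit hu).subst F = X := subst_substInvOfIsUnit_left _ hF hu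
  -- A left inverse `H` of `F` satisfies `H = H(F(G)) = G`, so `G` is a two-sided inverse.
  have hGF : G.subst F = X := by
    have h1 := subst_comp_subst_apply hsF hsG (F.substInvOfIsUnit hu)
    rw [hinv, h, subst_X hsG, X_subst] at h1
    rw [h1, hinv]
  have hl := isMatrixProduct_bellMatrix hF hG h
  have hr := isMatrixProduct_bellMatrix hG hF hGF
  constructor
  · rintro ⟨h1, -⟩
    exact IsMatrixProduct.eq_of_left_inverse (isLowerTriangular_bellMatrix hF)
      (isLowerTriangular_bellMatrix hG) hl h1
  · rintro rfl
    exact ⟨hr, hl⟩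

/-! ### Restricted Stirling and Lah numbers as coefficients -/

/-- A block is labelled by its own elements. Unordered collections of blocks, via `HasEGF.multiset`,
then become partitions. -/
theorem hasEGF_finset {ι : Type*} (φ : ℕ → ℚ) (R : Set ℕ) :
    HasEGF Finset.val {B : Finset ι | B.card ∈ R} (fun B => (B.card.factorial : ℚ) * φ B.card)
      (coefSeries φ R) := by
  intro S
  by_cases hS : S.card ∈ R
  · refine ⟨{S}, fun B => ?_, by simp [coefSeries, hS]⟩
    simp only [Finset.mem_singleton, Set.mem_ofPred_eq, Finset.val_inj]
    constructor
    · rintro rfl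
      exact ⟨hS, rfl⟩
    · exact fun h => h.2
  · refine ⟨∅, fun B => ?_, by simp [coefSeries, hS]⟩
    simp only [Finset.notMem_empty, Set.mem_ofPred_eq, Finset.val_inj, false_iff]
    rintro ⟨h, rfl⟩
    exact hS h

instance (R : Set ℕ) (n k : ℕ) : Finite (RestrictedPartition R n k) :=
  inferInstanceAs (Finite {P : Finpartition (Finset.univ : Finset (Fin n)) //
    P.parts.card = k ∧ ∀ B ∈ P.parts, B.card ∈ R})

/-- Weighted numbers of restricted partitions, with a weight that is multiplicative in the blocks
and depends on their sizes only. -/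
theorem sum_restrictedPartition {R : Set ℕ} (hR : 0 ∉ R) (φ : ℕ → ℚ) (n k : ℕ+)
    [Fintype (RestrictedPartition R n k)] :
    ∑ P : RestrictedPartition R n k, ∏ B : P.1.parts, ((B.1.card.factorial : ℚ) * φ B.1.card) =
      bellMatrix (coefSeries φ R) n k := by
  classical
  have hne : ∀ B ∈ {B : Finset (Fin n) | B.card ∈ R}, B.val ≠ 0 := by
    intro B hB h
    rw [Finset.val_eq_zero] at h
    subst h
    exact hR hB
  have h := hasEGF_finset (ι := Fin n) φ R
  obtain ⟨t, ht, hs⟩ := h.multiset hne (h.constantCoeff_eq_zero hne) k Finset.univ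
  rw [Finset.card_univ, Fintype.card_fin] at hs
  rw [bellMatrix, ← hs]
  refine Finset.sum_nbij (fun P => P.1.parts.val) ?_ ?_ ?_ ?_
  · intro P _
    rw [ht]
    refine ⟨⟨P.2.1, P.2.2⟩, ?_⟩
    have hd : Set.PairwiseDisjoint (P.1.parts : Set (Finset (Fin n))) id := P.1.disjoint
    have := P.1.biUnion_parts
    rw [← Finset.disjiUnion_eq_biUnion _ _ hd] at this
    exact congrArg Finset.val this
  · intro P _ Q _ hPQ
    exact Subtype.ext (Finpartition.ext (Finset.val_injective hPQ))
  · intro M hM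
    obtain ⟨⟨h1, h2⟩, h3⟩ := (ht M).1 hM
    change (M.map Finset.val).sum = Finset.univ.val at h3
    -- The labels of `M` add up to a set without repetition, so any two occurrences in `M` are
    -- disjoint, including two occurrences of one block.
    have hcons : ∀ (B C : Finset (Fin n)) (N : Multiset (Finset (Fin n))), M = B ::ₘ C ::ₘ N →
        Disjoint B C := by
      intro B C N hMN
      have hnd : (M.map Finset.val).sum.Nodup := h3 ▸ Finset.univ.nodup
      rw [hMN, Multiset.map_cons, Multiset.map_cons, Multiset.sum_cons, Multiset.sum_cons,
        Multiset.nodup_add] at hnd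
      rw [Finset.disjoint_left]
      exact fun i hi hi' => Multiset.disjoint_left.1 hnd.2.2 hi (Multiset.mem_add.2 (Or.inl hi'))
    have hM' : M.Nodup := by
      rw [Multiset.nodup_iff_ne_cons_cons]
      intro B N hMN
      have hB := hcons B B N hMN
      rw [disjoint_self, Finset.bot_eq_empty] at hB
      refine hne B (h2 B ?_) (by rw [hB]; rfl)
      rw [hMN]
      exact Multiset.mem_cons_self _ _
    have hdisj : ∀ B ∈ M, ∀ C ∈ M, B ≠ C → Disjoint B C := by
      intro B hB C hC hBC
      refine hcons B C ((M.erase B).erase C) ?_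
      rw [Multiset.cons_erase ((Multiset.mem_erase_of_ne hBC.symm).2 hC), Multiset.cons_erase hB]
    let P : Finpartition (Finset.univ : Finset (Fin n)) :=
      Finpartition.ofExistsUnique ⟨M, hM'⟩ (fun _ _ => Finset.subset_univ _) (by
        intro i _
        have hi : i ∈ (M.map Finset.val).sum := by
          rw [h3]
          exact Finset.mem_univ i
        obtain ⟨u, hu, hiu⟩ := Multiset.mem_join.1 hi
        obtain ⟨B, hB, rfl⟩ := Multiset.mem_map.1 hu
        refine ⟨B, ⟨hB, hiu⟩, fun C ⟨hC, hiC⟩ => ?_⟩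
        by_contra hne'
        exact Finset.disjoint_left.1 (hdisj C hC B hB hne') hiC hiu)
        (fun h => hne ∅ (h2 ∅ h) rfl)
    exact ⟨⟨P, h1, h2⟩, Finset.mem_coe.2 (Finset.mem_univ _), rfl⟩
  · intro P _
    rw [Finset.prod_coe_sort P.1.parts fun B => ((B.card.factorial : ℚ) * φ B.card)]
    rfl

theorem stirlingSecond_eq {R : Set ℕ} (hR : 0 ∉ R) :
    stirlingSecond R = bellMatrix (coefSeries (fun m => (m.factorial : ℚ)⁻¹) R) := by
  classical
  ext n k
  have := Fintype.ofFinite (RestrictedPartition R n k)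
  rw [stirlingSecond, ← sum_restrictedPartition hR, Nat.card_eq_fintype_card, Fintype.card,
    Finset.cast_card]
  refine Finset.sum_congr rfl fun P _ => (Finset.prod_eq_one fun B _ => ?_).symm
  exact mul_inv_cancel₀ (by positivity)

theorem lah_eq {R : Set ℕ} (hR : 0 ∉ R) : lah R = bellMatrix (coefSeries (fun _ => 1) R) := by
  classical
  ext n k
  have := Fintype.ofFinite (RestrictedPartition R n k)
  rw [lah, ← sum_restrictedPartition hR, Nat.card_sigma, Nat.cast_sum]
  refine Finset.sum_congr rfl fun P _ => ?_
  rw [Nat.card_pi, Nat.cast_prod]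
  refine Finset.prod_congr rfl fun B _ => ?_
  rw [mul_one, Nat.card_eq_fintype_card, Fintype.card_equiv B.1.equivFin.symm, Fintype.card_fin]

open Equiv.Perm in
-- One-point types are excluded because `cycleType` ignores fixed points.
theorem isCycleOn_univ_iff {α : Type*} [Fintype α] [DecidableEq α]
    (h : 2 ≤ Fintype.card α) (σ : Equiv.Perm α) :
    σ.IsCycleOn Set.univ ↔ σ.cycleType = {Fintype.card α} := by
  have hnt : (Set.univ : Set α).Nontrivial := by
    have := Fintype.one_lt_card_iff_nontrivial.1 h
    exact Set.nontrivial_univ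
  constructor
  · intro hσ
    have hc : σ.IsCycle := isCycle_iff_exists_isCycleOn.2 ⟨_, hnt, hσ, by simp⟩
    have hs : σ.support = Finset.univ :=
      Finset.eq_univ_of_forall fun a => mem_support.2 (hσ.apply_ne hnt (Set.mem_univ a))
    rw [hc.cycleType, hs, Finset.card_univ]
  · intro hσ
    have hc : σ.IsCycle := card_cycleType_eq_one.1 (by rw [hσ, Multiset.card_singleton])
    have hs : σ.support = Finset.univ := by
      rw [← Finset.card_eq_iff_eq_univ, ← sum_cycleType, hσ, Multiset.sum_singleton]
    have : {x | σ x ≠ x} = Set.univ := by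
      refine Set.eq_univ_of_forall fun a => ?_
      exact mem_support.1 (hs ▸ Finset.mem_univ a)
    exact this ▸ hc.isCycleOn

open Equiv.Perm in
theorem card_isCycleOn_univ {α : Type*} [Fintype α] (h : 1 ≤ Fintype.card α) :
    Nat.card {σ : Equiv.Perm α // σ.IsCycleOn Set.univ} = (Fintype.card α - 1).factorial := by
  classical
  rcases Nat.lt_or_ge (Fintype.card α) 2 with h2 | h2
  · have h1 : Fintype.card α = 1 := by omega
    have := Fintype.card_le_one_iff_subsingleton.1 h1.le
    rw [h1]
    exact Nat.card_eq_one_iff_unique.2 ⟨inferInstance, ⟨1, isCycleOn_of_subsingleton _ _⟩⟩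
  · rw [Nat.card_congr (Equiv.subtypeEquivRight (isCycleOn_univ_iff h2)),
      Nat.card_eq_fintype_card, Fintype.card_subtype, card_of_cycleType_singleton h2 le_rfl,
      Nat.choose_self, mul_one]

theorem stirlingFirst_eq {R : Set ℕ} (hR : 0 ∉ R) :
    stirlingFirst R = bellMatrix (coefSeries (fun m => (m : ℚ)⁻¹) R) := by
  classical
  ext n k
  have := Fintype.ofFinite (RestrictedPartition R n k)
  rw [stirlingFirst, ← sum_restrictedPartition hR, Nat.card_sigma, Nat.cast_sum]
  refine Finset.sum_congr rfl fun P _ => ?_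
  rw [Nat.card_pi, Nat.cast_prod]
  refine Finset.prod_congr rfl fun B _ => ?_
  have hB : B.1.card ≠ 0 := fun h => hR (h ▸ P.2.2 B.1 B.2)
  rw [card_isCycleOn_univ (by rw [Fintype.card_coe]; omega), Fintype.card_coe,
    ← Nat.mul_factorial_pred hB]
  push_cast
  field_simp

/-! ### Inverse matrices and good forests -/

/-- The admissible degrees of non-leaf vertices of `R(d)`-good trees, with and without left-odd
ancestry. -/
def goodDegrees (R : Set ℕ) (d : ℕ) : Bool → Set ℕ
  | true => stretch d '' rightEndpoints R
  | false => insert (d + 1) (stretch d '' leftEndpoints R)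

/-- An odd member `≥ 3` has both neighbours in `R`, so it is no endpoint; `1` is not in `a(R)` by
definition and not in `b(R)` because `2 ∈ R`. -/
theorem even_of_mem_endpoints {R : Set ℕ} (hpos : 0 ∉ R) (hone : 1 ∈ R) (hR : NoExposedOdds R)
    {r : ℕ} (hr : r ∈ leftEndpoints R ∪ rightEndpoints R) : Even r ∧ r ≠ 0 := by
  have h0 : r ≠ 0 := by
    rintro rfl
    rcases hr with hr | hr <;> exact hpos hr.1
  refine ⟨?_, h0⟩
  rw [← Nat.not_odd_iff_even]
  intro hodd
  have h2 := hR.1 hone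
  have h3 : r ≠ 1 → 3 ≤ r := by
    obtain ⟨i, rfl⟩ := hodd
    omega
  rcases hr with hr | hr
  · exact hr.2.2 (hR.2 r hr.1 hodd (h3 hr.2.1)).1
  · refine hr.2 ?_
    by_cases h1 : r = 1
    · rwa [h1]
    · exact (hR.2 r hr.1 hodd (h3 h1)).2

theorem exists_odd_of_mem_goodDegrees {R : Set ℕ} (hpos : 0 ∉ R) (hone : 1 ∈ R)
    (hR : NoExposedOdds R) (d : ℕ) (b : Bool) :
    ∀ n ∈ goodDegrees R d b, ∃ r, Odd r ∧ n = d * r + 1 := by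
  have key : ∀ r ∈ leftEndpoints R ∪ rightEndpoints R, ∃ i, Odd i ∧ stretch d r = d * i + 1 := by
    intro r hr
    obtain ⟨he, h0⟩ := even_of_mem_endpoints hpos hone hR hr
    exact ⟨r - 1, Nat.Even.sub_odd (Nat.one_le_iff_ne_zero.2 h0) he odd_one, rfl⟩
  rcases b with _ | _
  · rintro n (rfl | ⟨r, hr, rfl⟩)
    · exact ⟨1, odd_one, by rw [mul_one]⟩
    · exact key r (Or.inl hr)
  · rintro n ⟨r, hr, rfl⟩
    exact key r (Or.inr hr)

theorem mem_goodTrees_iff {Ord : List OTree → Prop} {R : Set ℕ} {d : ℕ} {T : OTree} :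
    T ∈ goodTrees Ord (d + 1) (goodDegrees R d) false ↔
      T.IsPhylogenetic ∧ T.IsGood R d ∧ ∀ p c, T.subtreeAt p = some (node c) → Ord c := by
  have hs : stretch d 2 = d + 1 := by simp [stretch]
  have hdeg : ∀ p S, T.subtreeAt p = some S →
      ((S.rootDegree = 0 ∨ S.rootDegree ∈ goodDegrees R d (oddAt (d + 1) p false T)) ↔
        (¬ HasLeftOddAncestry (stretch d 2) T p → T.degree p = 0 ∨ T.degree p = stretch d 2 ∨
          ∃ a ∈ leftEndpoints R, T.degree p = stretch d a) ∧
        (HasLeftOddAncestry (stretch d 2) T p → T.degree p = 0 ∨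
          ∃ b ∈ rightEndpoints R, T.degree p = stretch d b)) := by
    intro p S hS
    rw [hs, hasLeftOddAncestry_iff_oddAt (Nat.succ_ne_zero d), degree_eq hS]
    cases oddAt (d + 1) p false T <;> simp [goodDegrees, eq_comm]
  constructor
  · intro h
    refine ⟨fun p c hc => ((h p _ hc).1 c rfl).1, fun p ⟨S, hS⟩ => ?_,
      fun p c hc => ((h p _ hc).1 c rfl).2⟩
    exact (hdeg p S hS).1 (h p S hS).2
  · rintro ⟨h1, h2, h3⟩ p S hS
    refine ⟨?_, (hdeg p S hS).2 (h2 p ⟨S, hS⟩)⟩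
    rintro c rfl
    exact ⟨h1 p c hS, h3 p c hS⟩

/-- The forests of good trees with siblings ordered according to `Ord`, on the leaf labels
`1, …, n` and with `k` components. -/
def goodForests (Ord : List OTree → Prop) (R : Set ℕ) (d n k : ℕ) : Set (Multiset OTree) :=
  {F | (F.card = k ∧ ∀ T ∈ F, T ∈ goodTrees Ord (d + 1) (goodDegrees R d) false) ∧
    (F.map labels).sum = (Finset.Icc 1 n).val}

theorem card_and_sign_of_goodTrees {d : ℕ} {F : Multiset OTree}
    (h : ∀ T ∈ F, ∃ e, T.labels.card = 1 + d * e ∧ T.sign = (-1) ^ e) :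
    ∃ e, (F.map labels).sum.card = F.card + d * e ∧ (F.map sign).prod = (-1) ^ e := by
  induction F using Multiset.induction with
  | empty => exact ⟨0, by simp⟩
  | cons T F ih =>
    obtain ⟨e, h1, h2⟩ := ih fun S hS => h S (Multiset.mem_cons_of_mem hS)
    obtain ⟨e', h3, h4⟩ := h T (Multiset.mem_cons_self T F)
    refine ⟨e' + e, ?_, ?_⟩
    · rw [Multiset.map_cons, Multiset.sum_cons, Multiset.card_add, h1, h3, Multiset.card_cons]
      ring
    · rw [Multiset.map_cons, Multiset.prod_cons, h2, h4, pow_add]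

/-- The inverse of the matrix of numbers of partitions with block sizes in `R(d)` counts good
forests, up to signs. -/
theorem SiblingOrder.inverse_eq_goodForests {Ord : List OTree → Prop} (O : SiblingOrder Ord)
    {R : Set ℕ} (hpos : 0 ∉ R) (hone : 1 ∈ R) (hR : NoExposedOdds R) {d : ℕ} (hd : 1 ≤ d)
    {N : Matrix ℕ+ ℕ+ ℚ} (hN : N = bellMatrix (coefSeries O.coef (stretchSet R d))) :
    (∃! B, IsInverseMatrix N B) ∧ (∀ n k : ℕ+, (goodForests Ord R d n k).Finite) ∧
    ∀ B, IsInverseMatrix N B → ∀ n k : ℕ+,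
      ((d : ℤ) ∣ (n : ℤ) - (k : ℤ) → B n k = (-1 : ℚ) ^ (((n : ℤ) - (k : ℤ)) / (d : ℤ)) *
        ((goodForests Ord R d n k).ncard : ℚ)) ∧
      (¬ (d : ℤ) ∣ (n : ℤ) - (k : ℤ) → B n k = 0 ∧ goodForests Ord R d n k = ∅) := by
  have hDe := exists_odd_of_mem_goodDegrees hpos hone hR d
  have hD : ∀ b, ∀ n ∈ goodDegrees R d b, 2 ≤ n := by
    intro b n hn
    obtain ⟨r, hr, rfl⟩ := hDe b n hn
    exact Nat.succ_le_succ (Nat.mul_pos hd hr.pos)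
  have hl : 0 ∉ leftEndpoints R := fun h => hpos h.1
  -- `d + 1` is `s_d(2)`, and `2` is not a left endpoint because `1 ∈ R`.
  have hdM : d + 1 ∉ stretch d '' leftEndpoints R := by
    have : d + 1 = stretch d (1 + 1) := by simp [stretch]
    rw [this, mem_image_stretch hd hl]
    exact fun h => h.2.2 hone
  have hpos' : 0 ∉ stretchSet R d := by
    rintro ⟨r, -, h⟩
    simp [stretch] at h
  have hone' : 1 ∈ stretchSet R d := ⟨1, hone, by simp [stretch]⟩
  obtain ⟨A, B, hA, hA0, hAeq, hBeq⟩ := goodTrees_equations O hD rfl hdM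
  have hinv := O.subst_eq_X hd hA0 hpos' (zero_notMem hD rfl).2 hAeq hBeq
    (coefSeries_stretch hpos hone hd O.coef_one)
  have hiff := isInverseMatrix_bellMatrix_iff (F := coefSeries O.coef (stretchSet R d))
    (by simp [coefSeries, ← coeff_zero_eq_constantCoeff_apply, hpos', -coeff_zero_eq_constantCoeff])
    (by simp [coefSeries, hone', O.coef_one]) hA0 hinv
  rw [← hN] at hiff
  have hforest := fun n k : ℕ =>
    hA.multiset (fun T hT => labels_ne_zero_of_mem_goodTrees hD hT) hA0 k (Finset.Icc 1 n)
  simp only [Nat.card_Icc, Nat.add_sub_cancel] at hforest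
  choose t ht hs using hforest
  have hcoe : ∀ n k, goodForests Ord R d n k = (t n k : Set (Multiset OTree)) := by
    intro n k
    ext F
    exact (ht n k F).symm
  -- The exponent `e` is determined by `n`, `k` and `d`, so the signed sum is a common sign times a
  -- cardinality.
  have hsign : ∀ n k, ∀ F ∈ t n k, ∃ e, n = k + d * e ∧ (F.map sign).prod = (-1) ^ e := by
    intro n k F hF
    obtain ⟨⟨h1, h2⟩, h3⟩ := (ht n k F).1 hF
    obtain ⟨e, h4, h5⟩ := card_and_sign_of_goodTrees fun T hT =>
      card_labels_and_sign_of_mem_goodTrees hD hDe (h2 T hT)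
    refine ⟨e, ?_, h5⟩
    rw [← h1, ← h4]
    change (F.map labels).sum = _ at h3
    rw [h3]
    simp
  refine ⟨⟨_, (hiff _).2 rfl, fun B hB => (hiff B).1 hB⟩, fun n k => ?_, fun B hB n k => ?_⟩
  · rw [hcoe]
    exact Finset.finite_toSet _
  rw [(hiff B).1 hB, bellMatrix, ← hs, hcoe, Set.ncard_coe_finset]
  have hd0 : (d : ℤ) ≠ 0 := by exact_mod_cast (Nat.one_le_iff_ne_zero.1 hd)
  constructor
  · intro _
    rw [Finset.sum_congr rfl fun F hF => show (F.map sign).prod =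
      (-1 : ℚ) ^ (((n : ℤ) - (k : ℤ)) / (d : ℤ)) from ?_, Finset.sum_const, nsmul_eq_mul, mul_comm]
    obtain ⟨e, h1, h2⟩ := hsign n k F hF
    have : ((n : ℤ) - (k : ℤ)) / (d : ℤ) = e := by
      have h3 : ((n : ℕ) : ℤ) = k + d * e := by exact_mod_cast h1
      rw [h3, add_sub_cancel_left, Int.mul_ediv_cancel_left _ hd0]
    rw [this, h2, zpow_natCast]
  · intro hnd
    have : t n k = ∅ := by
      refine Finset.eq_empty_of_forall_notMem fun F hF => hnd ?_
      obtain ⟨e, h1, -⟩ := hsign n k F hF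
      have h3 : ((n : ℕ) : ℤ) = k + d * e := by exact_mod_cast h1
      exact ⟨e, by rw [h3, add_sub_cancel_left]⟩
    simp [this]

theorem mem_goodForests_iff {Ord : List OTree → Prop} {R : Set ℕ} {d n k : ℕ}
    {F : Multiset OTree} : F ∈ goodForests Ord R d n k ↔ F ∈ goodLinearForests R d n k ∧
      ∀ T ∈ F, ∀ p c, T.subtreeAt p = some (node c) → Ord c := by
  simp only [goodForests, goodLinearForests, orderedForests, Set.mem_ofPred_eq, mem_goodTrees_iff]
  constructor
  · rintro ⟨⟨h1, h2⟩, h3⟩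
    exact ⟨⟨⟨h1, fun T hT => (h2 T hT).1, h3⟩, fun T hT => (h2 T hT).2.1⟩,
      fun T hT => (h2 T hT).2.2⟩
  · rintro ⟨⟨⟨h1, h2, h3⟩, h4⟩, h5⟩
    exact ⟨⟨h1, fun T hT => ⟨h2 T hT, h4 T hT, h5 T hT⟩⟩, h3⟩

theorem theorem3p2 (R : Set ℕ) (hpos : 0 ∉ R) (hone : 1 ∈ R) (hR : NoExposedOdds R)
    (d : ℕ) (hd : 1 ≤ d) :
    -- the three matrices are invertible, with unique inverses
    (∃! B, IsInverseMatrix (stirlingSecond (stretchSet R d)) B) ∧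
    (∃! B, IsInverseMatrix (stirlingFirst (stretchSet R d)) B) ∧
    (∃! B, IsInverseMatrix (lah (stretchSet R d)) B) ∧
    -- all the sets of forests are finite
    (∀ n k : ℕ+, (goodIncreasingForests R d n k).Finite ∧ (goodMinFirstForests R d n k).Finite ∧
      (goodLinearForests R d n k).Finite) ∧
    -- the entries of the inverses
    ∀ S₂ S₁ L : Matrix ℕ+ ℕ+ ℚ,
      IsInverseMatrix (stirlingSecond (stretchSet R d)) S₂ →
      IsInverseMatrix (stirlingFirst (stretchSet R d)) S₁ →
      IsInverseMatrix (lah (stretchSet R d)) L →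
      ∀ n k : ℕ+,
        ((d : ℤ) ∣ (n : ℤ) - (k : ℤ) →
          S₂ n k = (-1 : ℚ) ^ (((n : ℤ) - (k : ℤ)) / (d : ℤ)) *
            ((goodIncreasingForests R d n k).ncard : ℚ) ∧
          S₁ n k = (-1 : ℚ) ^ (((n : ℤ) - (k : ℤ)) / (d : ℤ)) *
            ((goodMinFirstForests R d n k).ncard : ℚ) ∧
          L n k = (-1 : ℚ) ^ (((n : ℤ) - (k : ℤ)) / (d : ℤ)) *
            ((goodLinearForests R d n k).ncard : ℚ)) ∧
        (¬ (d : ℤ) ∣ (n : ℤ) - (k : ℤ) →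
          (S₂ n k = 0 ∧ S₁ n k = 0 ∧ L n k = 0) ∧
          goodIncreasingForests R d n k = ∅ ∧ goodMinFirstForests R d n k = ∅ ∧
          goodLinearForests R d n k = ∅) := by
  have hpos' : 0 ∉ stretchSet R d := by
    rintro ⟨r, -, h⟩
    simp [stretch] at h
  have hi : ∀ n k, goodIncreasingForests R d n k =
      goodForests (fun c => c.Pairwise fun S S' => S.maxLabel < S'.maxLabel) R d n k :=
    fun n k => Set.ext fun F => mem_goodForests_iff.symm
  have hm : ∀ n k, goodMinFirstForests R d n k =
      goodForests (fun c => ∀ S₀ ∈ c.head?, ∀ S ∈ c, S₀.minLabel ≤ S.minLabel) R d n k :=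
    fun n k => Set.ext fun F => mem_goodForests_iff.symm
  have hl : ∀ n k, goodLinearForests R d n k = goodForests (fun _ => True) R d n k :=
    fun n k => Set.ext fun F => by simp [mem_goodForests_iff]
  simp only [hi, hm, hl]
  obtain ⟨i1, i2, i3⟩ := increasingSiblings.inverse_eq_goodForests hpos hone hR hd
    (stirlingSecond_eq hpos')
  obtain ⟨m1, m2, m3⟩ := minFirstSiblings.inverse_eq_goodForests hpos hone hR hd
    (stirlingFirst_eq hpos')
  obtain ⟨l1, l2, l3⟩ := linearSiblings.inverse_eq_goodForests hpos hone hR hd (lah_eq hpos')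
  refine ⟨i1, m1, l1, fun n k => ⟨i2 n k, m2 n k, l2 n k⟩, fun S₂ S₁ L hS₂ hS₁ hL n k => ⟨?_, ?_⟩⟩
  · intro h
    exact ⟨(i3 S₂ hS₂ n k).1 h, (m3 S₁ hS₁ n k).1 h, (l3 L hL n k).1 h⟩
  · intro h
    have hi := (i3 S₂ hS₂ n k).2 h
    have hm := (m3 S₁ hS₁ n k).2 h
    have hl := (l3 L hL n k).2 h
    exact ⟨⟨hi.1, hm.1, hl.1⟩, hi.2, hm.2, hl.2⟩
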